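/- A hypergraph $H=(V,\mathcal E)$ is a finite vertex set $V$ together with a finite family $\mathcal E$ of non-empty subsets of $V$, its hyperedges; two members of the family count as distinct hyperedges even if they contain the same vertices. Let $N=\sum_{E\in\mathcal E}|E|$. A join tree of $H$ is a tree whose nodes are the hyperedges of $H$ such that, for every vertex $v$, the hyperedges containing $v$ induce a subtree. $H$ is acyclic if it has a join tree. The Sperner Family problem asks whether $H$ has two distinct hyperedges $E_i,E_j$ with $E_i\subseteq E_j$. Theorem. (1) For every acyclic hypergraph $H$ and every join tree $T$ of $H$: $H$ has two distinct hyperedges $E_i,E_j$ with $E_i\subseteq E_j$ if and only if $T$ has an edge $EE'$ whose separator $E\cap E'$ satisfies $|E\cap E'|=|E|$ or $|E\cap E'|=|E'|$. (2) There is a linear-time algorithm that solves the Sperner Family problem for acyclic hypergraphs. That is, there are a random access machine program $P$ (unit cost per instruction: constants, copying, addition, truncated subtraction, indirect loads and stores, comparisons and jumps) and a constant $C$ such that, for every acyclic hypergraph $H$ in which every vertex lies in some hyperedge (for example, one with a connected incidence graph), given by the adjacency lists of its incidence graph in any order, $P$ halts after at most $C\cdot N$ steps, with output $1$ if $H$ has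 two distinct hyperedges $E_i,E_j$ with $E_i\subseteq E_j$ and with output $0$ otherwise, and no number larger than $C\cdot N$ occurs in a register or memory cell during the computation (so words of $O(\log N)$ bits suffice). -/

import Mathlib

/-- A hypergraph with vertex set `V` whose hyperedges are indexed by `E` and each contain a positive
(finite) number of vertices. Equivalently, its bipartite incidence graph: `v : V` and `e : E` are
adjacent when `v ∈ edge e`. Hyperedges with different indices are distinct hyperedges, even when
they contain the same vertices. -/
structure IndexedHypergraph (V E : Type*) where
  edge : E → Finset V
  nonempty : ∀ e, (edge e).Nonempty

namespace IndexedHypergraph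

variable {V E : Type*}

/-- `N`, the total size of all hyperedges. -/
def totalSize [Fintype E] (H : IndexedHypergraph V E) : ℕ :=
  ∑ e, (H.edge e).card

/-- `T` is a join tree: a tree whose nodes are the hyperedges, such that for every vertex `v` the
hyperedges containing `v` induce a subtree. -/
structure IsJoinTree (H : IndexedHypergraph V E) (T : SimpleGraph E) : Prop where
  isTree : T.IsTree
  preconnected : ∀ v : V, (T.induce {e | v ∈ H.edge e}).Preconnected

/-- A hypergraph is (`α`-)acyclic if it admits a join tree. -/
def IsAcyclic (H : IndexedHypergraph V E) : Prop :=
  ∃ T : SimpleGraph E, H.IsJoinTree T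

/-- The question of the Sperner Family problem: are there two distinct hyperedges, one of which is
contained in the other? -/
def HasSpernerPair (H : IndexedHypergraph V E) : Prop :=
  ∃ e f : E, e ≠ f ∧ H.edge e ⊆ H.edge f

/-- The separator `E ∩ E'` of two hyperedges (that are adjacent in a join tree). -/
def separator [DecidableEq V] (H : IndexedHypergraph V E) (e f : E) : Finset V :=
  H.edge e ∩ H.edge f

/-- Adjacency lists of the incidence graph of a hypergraph with vertices `0, …, n - 1` and
hyperedges `0, …, m - 1`, each list in an arbitrary order. -/
structure AdjacencyLists {n m : ℕ} (H : IndexedHypergraph (Fin n) (Fin m)) where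
  edgesAt : Fin n → List (Fin m)
  edgesAt_nodup : ∀ v, (edgesAt v).Nodup
  mem_edgesAt : ∀ v e, e ∈ edgesAt v ↔ v ∈ H.edge e
  verticesOf : Fin m → List (Fin n)
  verticesOf_nodup : ∀ e, (verticesOf e).Nodup
  mem_verticesOf : ∀ e v, v ∈ verticesOf e ↔ v ∈ H.edge e

/-- The input as a sequence of numbers: `n`, `m`, then the adjacency list of each vertex and then
that of each hyperedge, every list preceded by its length. -/
def AdjacencyLists.encode {n m : ℕ} {H : IndexedHypergraph (Fin n) (Fin m)}
    (A : H.AdjacencyLists) : List ℕ :=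
  [n, m] ++
  (List.finRange n).flatMap (fun v => (A.edgesAt v).length :: (A.edgesAt v).map Fin.val) ++
  (List.finRange m).flatMap (fun e => (A.verticesOf e).length :: (A.verticesOf e).map Fin.val)

end IndexedHypergraph

/-! ### Random access machines -/

namespace RAM

/-- Instructions of a random access machine: `d`, `a`, `b` name registers, `k` is a constant and
`l` is a position in the program. -/
inductive Instr where
  /-- `d := k` -/
  | const (d k : ℕ)
  /-- `d := a` -/
  | move (d a : ℕ)
  /-- `d := a + b` -/
  | add (d a b : ℕ)
  /-- `d := max (a - b) 0` -/
  | sub (d a b : ℕ)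
  /-- `d := memory[a]` -/
  | load (d a : ℕ)
  /-- `memory[a] := b` -/
  | store (a b : ℕ)
  /-- `goto l` -/
  | jump (l : ℕ)
  /-- `if a < b then goto l` -/
  | jumpLt (a b l : ℕ)
  /-- `if a = b then goto l` -/
  | jumpEq (a b l : ℕ)

/-- A program is a finite list of instructions. -/
abbrev Program := List Instr

/-- A configuration: program counter, contents of the registers, contents of the memory. -/
structure Config where
  pc : ℕ
  reg : ℕ → ℕ
  mem : ℕ → ℕ

/-- The effect of one instruction. -/
def Instr.exec (c : Config) : Instr → Config
  | const d k => ⟨c.pc + 1, Function.update c.reg d k, c.mem⟩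
  | move d a => ⟨c.pc + 1, Function.update c.reg d (c.reg a), c.mem⟩
  | add d a b => ⟨c.pc + 1, Function.update c.reg d (c.reg a + c.reg b), c.mem⟩
  | sub d a b => ⟨c.pc + 1, Function.update c.reg d (c.reg a - c.reg b), c.mem⟩
  | load d a => ⟨c.pc + 1, Function.update c.reg d (c.mem (c.reg a)), c.mem⟩
  | store a b => ⟨c.pc + 1, c.reg, Function.update c.mem (c.reg a) (c.reg b)⟩
  | jump l => ⟨l, c.reg, c.mem⟩
  | jumpLt a b l => ⟨if c.reg a < c.reg b then l else c.pc + 1, c.reg, c.mem⟩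
  | jumpEq a b l => ⟨if c.reg a = c.reg b then l else c.pc + 1, c.reg, c.mem⟩

/-- The machine has halted when the program counter has left the program. -/
def Halted (P : Program) (c : Config) : Prop :=
  P.length ≤ c.pc

/-- One step of the machine: execute the current instruction (nothing, if the machine has
halted). -/
def step (P : Program) (c : Config) : Config :=
  match P[c.pc]? with
  | some i => i.exec c
  | none => c

/-- Initially the input is in the memory, from address `0` on; everything else is `0`. -/
def init (input : List ℕ) : Config :=
  ⟨0, fun _ => 0, fun i => input.getD i 0⟩

/-- Started on `input`, the program `P` halts after at most `t` steps with `output` in register `0`,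
and no number larger than `w` occurs in a register or in the memory until then (so that words of
`⌊log₂ w⌋ + 1` bits suffice, and at most the addresses `0, …, w` are used). -/
def ComputesWithin (P : Program) (input : List ℕ) (output t w : ℕ) : Prop :=
  ∃ s ≤ t, Halted P ((step P)^[s] (init input)) ∧
    ((step P)^[s] (init input)).reg 0 = output ∧
    ∀ r ≤ s, ∀ i, ((step P)^[r] (init input)).reg i ≤ w ∧ ((step P)^[r] (init input)).mem i ≤ w

end RAM

/-! ### Join trees -/

/-- `ReachIn T U x y`: the graph `T` has a walk from `x` to `y` all of whose edges lie in `U`. -/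
def SimpleGraph.ReachIn {E : Type*} (T : SimpleGraph E) (U : Set E) : E → E → Prop :=
  Relation.ReflTransGen fun a b => T.Adj a b ∧ a ∈ U ∧ b ∈ U

namespace SimpleGraph.ReachIn

variable {E : Type*} {T : SimpleGraph E} {U W : Set E} {x y : E}

theorem symm (h : T.ReachIn U x y) : T.ReachIn U y x := by
  induction h with
  | refl => exact .refl
  | tail _ h ih => exact .head ⟨h.1.symm, h.2.2, h.2.1⟩ ih

theorem mono (hUW : U ⊆ W) (h : T.ReachIn U x y) : T.ReachIn W x y :=
  h.lift id fun _ _ h => ⟨h.1, hUW h.2.1, hUW h.2.2⟩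

theorem mem_right (h : T.ReachIn U x y) (hx : x ∈ U) : y ∈ U := by
  induction h with
  | refl => exact hx
  | tail _ h _ => exact h.2.2

/-- The last node before `e` on a walk from `x` to `e`. -/
theorem exists_adj {e : E} (h : T.ReachIn U x e) (hne : x ≠ e) :
    ∃ n ∈ U, T.Adj n e ∧ T.ReachIn (U \ {e}) n x := by
  induction h using Relation.ReflTransGen.head_induction_on with
  | refl => exact absurd rfl hne
  | @head a b hab _ ih =>
    by_cases hb : b = e
    · subst hb
      exact ⟨a, hab.2.1, hab.1, .refl⟩
    · obtain ⟨n, hn, hadj, hr⟩ := ih hb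
      exact ⟨n, hn, hadj, hr.tail ⟨hab.1.symm, ⟨hab.2.2, hb⟩, hab.2.1, hne⟩⟩

end SimpleGraph.ReachIn

namespace IndexedHypergraph

variable {V E : Type*} {H : IndexedHypergraph V E} {T : SimpleGraph E}

theorem IsJoinTree.reachIn (hT : H.IsJoinTree T) {v : V} {x y : E} (hx : v ∈ H.edge x)
    (hy : v ∈ H.edge y) : T.ReachIn {e | v ∈ H.edge e} x y := by
  have h := hT.preconnected v ⟨x, hx⟩ ⟨y, hy⟩
  rw [SimpleGraph.reachable_iff_reflTransGen] at h
  exact h.lift Subtype.val fun a b hab => ⟨hab, a.2, b.2⟩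

/-- A vertex of `e` that also lies in a hyperedge beyond the neighbour `n` of `e` lies in `n`. -/
theorem IsJoinTree.mem_edge_of_adj (hT : H.IsJoinTree T) {n e x : E} (hne : T.Adj n e)
    (hx : T.ReachIn {e}ᶜ n x) {v : V} (hvx : v ∈ H.edge x) (hve : v ∈ H.edge e) :
    v ∈ H.edge n := by
  by_contra hvn
  have hb := SimpleGraph.isAcyclic_iff_forall_adj_isBridge.mp hT.isTree.isAcyclic hne
  rw [SimpleGraph.isBridge_iff, SimpleGraph.reachable_iff_reflTransGen] at hb
  refine hb (Relation.ReflTransGen.trans (b := x) ?_ ?_)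
  · refine hx.lift id fun a b h => ?_
    have h1 : a ≠ e := h.2.1
    have h2 : b ≠ e := h.2.2
    simp [SimpleGraph.deleteEdges_adj, h.1, h1, h2]
  · refine (hT.reachIn hvx hve).lift id fun a b h => ?_
    have h1 : a ≠ n := fun h' => hvn (h' ▸ h.2.1)
    have h2 : b ≠ n := fun h' => hvn (h' ▸ h.2.2)
    simp [SimpleGraph.deleteEdges_adj, h.1, h1, h2]

/-- Join trees detect Sperner pairs on their edges. -/
theorem IsJoinTree.hasSpernerPair_iff [DecidableEq V] (hT : H.IsJoinTree T) :
    H.HasSpernerPair ↔ ∃ e f : E, T.Adj e f ∧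
      ((H.separator e f).card = (H.edge e).card ∨
        (H.separator e f).card = (H.edge f).card) := by
  constructor
  · rintro ⟨e, f, hne, hef⟩
    have hr : T.ReachIn Set.univ f e := by
      have h := hT.isTree.connected.preconnected f e
      rw [SimpleGraph.reachable_iff_reflTransGen] at h
      exact h.lift id fun _ _ h => ⟨h, trivial, trivial⟩
    obtain ⟨n, -, hadj, hn⟩ := hr.exists_adj hne.symm
    refine ⟨e, n, hadj.symm, Or.inl ?_⟩
    rw [separator, Finset.inter_eq_left.mpr]
    intro v hv
    exact hT.mem_edge_of_adj hadj (hn.mono fun _ ha => ha.2) (hef hv) hv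
  · rintro ⟨e, f, hadj, h | h⟩
    · refine ⟨e, f, hadj.ne, ?_⟩
      rw [← Finset.inter_eq_left]
      exact Finset.eq_of_subset_of_card_le Finset.inter_subset_left h.ge
    · refine ⟨f, e, hadj.ne.symm, ?_⟩
      rw [← Finset.inter_eq_right]
      exact Finset.eq_of_subset_of_card_le Finset.inter_subset_right h.ge

/-! ### Maximum cardinality search

A list of hyperedges records the hyperedges selected so far, the most recent one first. -/

open Classical in
/-- The vertices of `e` that lie in a hyperedge of the list. -/
noncomputable def shared (H : IndexedHypergraph V E) (l : List E) (e : E) : Finset V :=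
  (H.edge e).filter fun v => ∃ f ∈ l, v ∈ H.edge f

theorem mem_shared {l : List E} {e : E} {v : V} :
    v ∈ H.shared l e ↔ v ∈ H.edge e ∧ ∃ f ∈ l, v ∈ H.edge f := by
  simp [shared]

theorem shared_subset (H : IndexedHypergraph V E) (l : List E) (e : E) :
    H.shared l e ⊆ H.edge e :=
  fun _ hv => (mem_shared.mp hv).1

@[simp] theorem shared_nil (e : E) : H.shared [] e = ∅ := by
  simp [shared]

/-- What `e` shares with the list lies in a single hyperedge of the list. -/
def Attached (H : IndexedHypergraph V E) (l : List E) (e : E) : Prop :=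
  H.shared l e = ∅ ∨ ∃ f ∈ l, H.shared l e ⊆ H.edge f

/-- Every component of the tree on the hyperedges outside the list has a node that shares most with
the list, and this node is attached to a single hyperedge of the list. -/
def ComponentsAttached (H : IndexedHypergraph V E) (T : SimpleGraph E) (l : List E) : Prop :=
  ∀ e, e ∉ l → ∃ r, T.ReachIn {x | x ∉ l} e r ∧ H.Attached l r ∧
    ∀ x, T.ReachIn {x | x ∉ l} e x → H.shared l x ⊆ H.shared l r

theorem componentsAttached_nil : H.ComponentsAttached T [] :=
  fun e _ => ⟨e, .refl, by simp [Attached], by simp⟩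

/-- `e` is a candidate for the next selection. -/
def IsMaxShared (H : IndexedHypergraph V E) (l : List E) (e : E) : Prop :=
  e ∉ l ∧ ∀ x, x ∉ l → (H.shared l x).card ≤ (H.shared l e).card

theorem IsMaxShared.card_shared_cons_le {l : List E} {e f : E}
    (h : H.IsMaxShared l e) (hf : f ∉ l) : (H.shared (e :: l) f).card ≤ (H.edge e).card := by
  classical
  have hsub : H.shared (e :: l) f ⊆ H.shared l f ∪ (H.edge e \ H.shared l e) := by
    intro v hv
    simp only [mem_shared, List.mem_cons, exists_eq_or_imp, Finset.mem_union,
      Finset.mem_sdiff] at hv ⊢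
    by_cases hl : ∃ f ∈ l, v ∈ H.edge f
    · exact Or.inl ⟨hv.1, hl⟩
    · exact Or.inr ⟨hv.2.resolve_right hl, fun h => hl h.2⟩
  have h1 := (Finset.card_le_card hsub).trans (Finset.card_union_le _ _)
  have h2 := Finset.card_le_card (H.shared_subset l e)
  have h3 := h.2 f hf
  rw [Finset.card_sdiff_of_subset (H.shared_subset l e)] at h1
  omega

theorem ComponentsAttached.exists_root {l : List E} (h : H.ComponentsAttached T l) {e : E}
    (he : H.IsMaxShared l e) : H.Attached l e ∧
      ∀ x, T.ReachIn {x | x ∉ l} e x → H.shared l x ⊆ H.shared l e := by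
  obtain ⟨r, hr, hatt, hmax⟩ := h e he.1
  have heq : H.shared l e = H.shared l r :=
    Finset.eq_of_subset_of_card_le (hmax e .refl) (he.2 r (hr.mem_right he.1))
  rw [Attached, heq]
  exact ⟨hatt, hmax⟩

theorem ComponentsAttached.cons {l : List E} (hT : H.IsJoinTree T)
    (h : H.ComponentsAttached T l) {e : E} (he : H.IsMaxShared l e) :
    H.ComponentsAttached T (e :: l) := by
  obtain ⟨-, hmax⟩ := h.exists_root he
  have hsub : {x | x ∉ e :: l} ⊆ {x | x ∉ l} := fun x hx => by
    simp only [Set.mem_ofPred_eq, List.mem_cons, not_or] at hx ⊢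
    exact hx.2
  have hne : {x | x ∉ e :: l} ⊆ {e}ᶜ := fun x hx => by
    simp only [Set.mem_ofPred_eq, List.mem_cons, not_or] at hx
    exact hx.1
  intro x₀ hx₀
  have hx₀' : x₀ ∉ l := hsub hx₀
  have hx₀e : x₀ ≠ e := hne hx₀
  by_cases hreach : T.ReachIn {x | x ∉ l} x₀ e
  · obtain ⟨n, hnl, hadj, hn⟩ := hreach.exists_adj hx₀e
    have hdiff : {x | x ∉ l} \ {e} ⊆ {x | x ∉ e :: l} := fun x hx => by
      simpa using And.intro hx.2 hx.1
    have hn := hn.mono hdiff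
    have hcover : ∀ x, T.ReachIn {x | x ∉ e :: l} n x → ∀ v ∈ H.shared (e :: l) x,
        v ∈ H.edge e := by
      intro x hx v hv
      obtain ⟨hvx, f, hf, hvf⟩ := mem_shared.mp hv
      rcases List.mem_cons.mp hf with rfl | hf
      · exact hvf
      · have hex : T.ReachIn {x | x ∉ l} e x :=
          (hx.mono hsub).head ⟨hadj.symm, he.1, hnl⟩
        exact H.shared_subset _ _ (hmax x hex (mem_shared.mpr ⟨hvx, f, hf, hvf⟩))
    refine ⟨n, hn.symm, Or.inr ⟨e, by simp, hcover n .refl⟩, fun x hx v hv => ?_⟩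
    have hnx : T.ReachIn {x | x ∉ e :: l} n x := hn.trans hx
    have hve := hcover x hnx v hv
    exact mem_shared.mpr ⟨hT.mem_edge_of_adj hadj (hnx.mono hne) (mem_shared.mp hv).1 hve,
      e, by simp, hve⟩
  · obtain ⟨r, hr, hatt, hmax₀⟩ := h x₀ hx₀'
    have hlift : ∀ y, T.ReachIn {x | x ∉ l} x₀ y → T.ReachIn {x | x ∉ e :: l} x₀ y := by
      intro y hy
      induction hy with
      | refl => exact .refl
      | @tail b c hb hbc ih =>
        refine ih.tail ⟨hbc.1, ?_, ?_⟩ <;> simp only [Set.mem_ofPred_eq, List.mem_cons, not_or]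
        · exact ⟨fun h => hreach (h ▸ hb), hbc.2.1⟩
        · exact ⟨fun h => hreach (h ▸ hb.tail hbc), hbc.2.2⟩
    have heq : ∀ x, T.ReachIn {x | x ∉ l} x₀ x → H.shared (e :: l) x = H.shared l x := by
      intro x hx
      ext v
      simp only [mem_shared, List.mem_cons, exists_eq_or_imp]
      refine ⟨fun ⟨hvx, hv⟩ => ⟨hvx, ?_⟩, fun ⟨hvx, hv⟩ => ⟨hvx, Or.inr hv⟩⟩
      by_contra hvl
      refine hreach (hx.trans ((hT.reachIn hvx (hv.resolve_right hvl)).mono fun y hy hyl => ?_))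
      exact hvl ⟨y, hyl, hy⟩
    refine ⟨r, hlift r hr, ?_, fun x hx => ?_⟩
    · rw [Attached, heq r hr]
      exact hatt.imp id fun ⟨f, hf, hs⟩ => ⟨f, List.mem_cons_of_mem _ hf, hs⟩
    · rw [heq r hr, heq x (hx.mono hsub)]
      exact hmax₀ x (hx.mono hsub)

/-- The list was built by attaching one new hyperedge after the other. -/
def RunningIntersection (H : IndexedHypergraph V E) : List E → Prop
  | [] => True
  | e :: l => e ∉ l ∧ H.Attached l e ∧ RunningIntersection H l

theorem RunningIntersection.nodup {l : List E} (h : H.RunningIntersection l) : l.Nodup := by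
  induction l with
  | nil => exact List.nodup_nil
  | cons e l ih => exact List.nodup_cons.mpr ⟨h.1, ih h.2.2⟩

open Classical in
/-- The number of the selection step that first covered `v` (`0` if `v` is not covered). -/
noncomputable def coverTime (H : IndexedHypergraph V E) : List E → V → ℕ
  | [], _ => 0
  | e :: l, v =>
    if coverTime H l v ≠ 0 then coverTime H l v else if v ∈ H.edge e then l.length + 1 else 0

/-- One more than the size of the hyperedge selected in step `t` (`0` if there is none). -/
def sizeSucc (H : IndexedHypergraph V E) : List E → ℕ → ℕ
  | [], _ => 0
  | e :: l, t => if t = l.length + 1 then (H.edge e).card + 1 else sizeSucc H l t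

/-- The last step that covered one of the vertices of `e`. -/
noncomputable def lastCoverTime (H : IndexedHypergraph V E) (l : List E) (e : E) : ℕ :=
  (H.edge e).sup (H.coverTime l)

/-- The test for a Sperner pair that consists of `e` and a hyperedge of the list. -/
def PairFoundAt (H : IndexedHypergraph V E) (l : List E) (e : E) : Prop :=
  (H.shared l e).card = (H.edge e).card ∨
    (H.shared l e).card + 1 = H.sizeSucc l (H.lastCoverTime l e)

/-- Some test was successful. -/
def PairFound (H : IndexedHypergraph V E) : List E → Prop
  | [] => False
  | e :: l => PairFound H l ∨ H.PairFoundAt l e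

theorem coverTime_le (l : List E) (v : V) : H.coverTime l v ≤ l.length := by
  induction l with
  | nil => simp [coverTime]
  | cons e l ih =>
    simp only [coverTime, List.length_cons]
    split_ifs <;> omega

theorem coverTime_ne_zero_iff {l : List E} {v : V} :
    H.coverTime l v ≠ 0 ↔ ∃ f ∈ l, v ∈ H.edge f := by
  induction l with
  | nil => simp [coverTime]
  | cons e l ih =>
    simp only [coverTime, List.mem_cons, exists_eq_or_imp, ← ih]
    split_ifs <;> simp_all

theorem sizeSucc_zero (l : List E) : H.sizeSucc l 0 = 0 := by
  induction l with
  | nil => rfl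
  | cons e l ih => simp [sizeSucc, ih]

theorem RunningIntersection.exists_sizeSucc {l : List E} (hl : H.RunningIntersection l)
    {X : Finset V} {f : E} (hf : f ∈ l) (hX : X ⊆ H.edge f) {t : ℕ}
    (ht : ∀ v ∈ X, H.coverTime l v ≤ t) {v₀ : V} (hv₀ : v₀ ∈ X) (hv₀t : H.coverTime l v₀ = t) :
    ∃ g ∈ l, H.sizeSucc l t = (H.edge g).card + 1 ∧ X ⊆ H.edge g := by
  induction l generalizing f with
  | nil => simp at hf
  | cons e l ih =>
    by_cases hcov : ∀ v ∈ X, H.coverTime l v ≠ 0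
    · have hc : ∀ v ∈ X, H.coverTime (e :: l) v = H.coverTime l v := fun v hv => by
        simp [coverTime, hcov v hv]
      have hg : ∃ g ∈ l, X ⊆ H.edge g := by
        rcases List.mem_cons.mp hf with rfl | hf
        · have hXs : X ⊆ H.shared l f := fun v hv =>
            mem_shared.mpr ⟨hX hv, coverTime_ne_zero_iff.mp (hcov v hv)⟩
          rcases hl.2.1 with h0 | ⟨g, hg, hs⟩
          · rw [h0] at hXs
            exact absurd (hXs hv₀) (by simp)
          · exact ⟨g, hg, hXs.trans hs⟩
        · exact ⟨f, hf, hX⟩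
      obtain ⟨g, hg, hXg⟩ := hg
      rw [hc v₀ hv₀] at hv₀t
      obtain ⟨g', hg', hs, hXg'⟩ := ih hl.2.2 hg hXg (fun v hv => hc v hv ▸ ht v hv) hv₀t
      have hlt : t ≠ l.length + 1 := by
        have := H.coverTime_le l v₀
        omega
      exact ⟨g', List.mem_cons_of_mem _ hg', by simp [sizeSucc, hlt, hs], hXg'⟩
    · push Not at hcov
      obtain ⟨v, hv, hv0⟩ := hcov
      have hvl : ∀ g ∈ l, v ∉ H.edge g := fun g hg hvg =>
        coverTime_ne_zero_iff.mpr ⟨g, hg, hvg⟩ hv0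
      obtain rfl : f = e := (List.mem_cons.mp hf).resolve_right fun h => hvl f h (hX hv)
      have h1 : H.coverTime (f :: l) v = l.length + 1 := by simp [coverTime, hv0, hX hv]
      have h2 := H.coverTime_le (f :: l) v₀
      have h3 := ht v hv
      have h4 : t = l.length + 1 := by
        simp only [List.length_cons] at h2
        omega
      exact ⟨f, by simp, by simp [sizeSucc, h4], hX⟩

theorem Attached.exists_sizeSucc {l : List E} {e : E} (he : H.Attached l e)
    (hl : H.RunningIntersection l) (hne : (H.shared l e).Nonempty) :
    ∃ g ∈ l, H.sizeSucc l (H.lastCoverTime l e) = (H.edge g).card + 1 ∧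
      H.shared l e ⊆ H.edge g := by
  obtain ⟨f, hf, hs⟩ := he.resolve_left hne.ne_empty
  obtain ⟨v, hv, hvt⟩ := Finset.exists_mem_eq_sup (H.edge e) (H.nonempty e) (H.coverTime l)
  have hle : ∀ w ∈ H.shared l e, H.coverTime l w ≤ H.lastCoverTime l e := fun w hw =>
    Finset.le_sup (f := H.coverTime l) (H.shared_subset l e hw)
  refine hl.exists_sizeSucc hf hs hle (v₀ := v) ?_ hvt.symm
  obtain ⟨w, hw⟩ := hne
  have h1 := coverTime_ne_zero_iff.mpr (mem_shared.mp hw).2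
  have h2 := hle w hw
  refine mem_shared.mpr ⟨hv, coverTime_ne_zero_iff.mp ?_⟩
  rw [← hvt]
  change H.lastCoverTime l e ≠ 0
  omega

/-- On a list with the running intersection property the tests find a Sperner pair if there is
one. -/
theorem RunningIntersection.pairFound_iff {l : List E} (hl : H.RunningIntersection l) :
    H.PairFound l ↔ ∃ e ∈ l, ∃ f ∈ l, e ≠ f ∧ H.edge e ⊆ H.edge f := by
  induction l with
  | nil => simp [PairFound]
  | cons e l ih =>
    obtain ⟨hel, hatt, hl⟩ := hl
    constructor
    · rintro (h | h | h)
      · obtain ⟨f, hf, g, hg, h⟩ := (ih hl).mp h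
        exact ⟨f, List.mem_cons_of_mem _ hf, g, List.mem_cons_of_mem _ hg, h⟩
      · have hs := Finset.eq_of_subset_of_card_le (H.shared_subset l e) h.ge
        rcases hatt with h0 | ⟨f, hf, hsf⟩
        · exact absurd (hs ▸ h0) (H.nonempty e).ne_empty
        · exact ⟨e, by simp, f, by simp [hf], fun h => hel (h ▸ hf), hs ▸ hsf⟩
      · have hne : (H.shared l e).Nonempty := by
          by_contra hne
          have h0 : H.lastCoverTime l e = 0 := by
            rw [lastCoverTime, ← bot_eq_zero, Finset.sup_eq_bot_iff]
            intro v hv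
            by_contra hv0
            exact hne ⟨v, mem_shared.mpr ⟨hv, coverTime_ne_zero_iff.mp hv0⟩⟩
          rw [h0, sizeSucc_zero] at h
          omega
        obtain ⟨g, hg, hsz, hsg⟩ := hatt.exists_sizeSucc hl hne
        have hs := Finset.eq_of_subset_of_card_le hsg (by omega)
        exact ⟨g, by simp [hg], e, by simp, fun h => hel (h ▸ hg), hs ▸ H.shared_subset l e⟩
    · rintro ⟨a, ha, b, hb, hab, hsub⟩
      by_cases hp : H.PairFound l
      · exact Or.inl hp
      have hno : ∀ a ∈ l, ∀ b ∈ l, H.edge a ⊆ H.edge b → a = b := by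
        intro a ha b hb hs
        by_contra hne
        exact hp ((ih hl).mpr ⟨a, ha, b, hb, hne, hs⟩)
      right
      rcases List.mem_cons.mp ha with rfl | ha'
      · have hb := (List.mem_cons.mp hb).resolve_left (Ne.symm hab)
        left
        congr 1
        exact (H.shared_subset l a).antisymm fun v hv => mem_shared.mpr ⟨hv, b, hb, hsub hv⟩
      · rcases List.mem_cons.mp hb with rfl | hb'
        · have hs : H.edge a ⊆ H.shared l b := fun v hv => mem_shared.mpr ⟨hsub hv, a, ha', hv⟩
          obtain ⟨g, hg, hsz, hsg⟩ := hatt.exists_sizeSucc hl ((H.nonempty a).mono hs)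
          obtain rfl := hno a ha' g hg (hs.trans hsg)
          right
          rw [hsz, hs.antisymm hsg]
        · exact absurd (hno a ha' b hb' hsub) hab

end IndexedHypergraph

/-! ### A structured language for random access machines -/

namespace RAM

/-- All registers and all memory cells are at most `w`. -/
def Bounded (w : ℕ) (c : Config) : Prop :=
  ∀ i, c.reg i ≤ w ∧ c.mem i ≤ w

theorem Bounded.update_reg {w pc pc' d k : ℕ} {reg mem : ℕ → ℕ} (h : Bounded w ⟨pc, reg, mem⟩)
    (hk : k ≤ w) : Bounded w ⟨pc', Function.update reg d k, mem⟩ := by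
  intro i
  refine ⟨?_, (h i).2⟩
  by_cases hi : i = d
  · simpa [hi] using hk
  · simpa [hi] using (h i).1

theorem Bounded.update_mem {w pc pc' d k : ℕ} {reg mem : ℕ → ℕ} (h : Bounded w ⟨pc, reg, mem⟩)
    (hk : k ≤ w) : Bounded w ⟨pc', reg, Function.update mem d k⟩ := by
  intro i
  refine ⟨(h i).1, ?_⟩
  by_cases hi : i = d
  · simpa [hi] using hk
  · simpa [hi] using (h i).2

/-- `P` runs from one configuration to another in exactly `t` steps, and no number larger than `w`
occurs. -/
inductive Reach (P : Program) (w : ℕ) : ℕ → Config → Config → Prop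
  | refl {c} (h : Bounded w c) : Reach P w 0 c c
  | head {t c c'} (h : Bounded w c) (h' : Reach P w t (step P c) c') : Reach P w (t + 1) c c'

namespace Reach

variable {P : Program} {w t t' : ℕ} {c c' c'' : Config}

theorem trans (h : Reach P w t c c') (h' : Reach P w t' c' c'') : Reach P w (t + t') c c'' := by
  induction h with
  | refl => simpa using h'
  | head hb _ ih =>
    rw [Nat.add_right_comm]
    exact .head hb (ih h')

theorem of_exec {i : Instr} (hi : P[c.pc]? = some i) (hc : Bounded w c)
    (hc' : Bounded w (i.exec c)) : Reach P w 1 c (i.exec c) := by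
  have h : step P c = i.exec c := by simp [step, hi]
  exact .head hc (by rw [h]; exact .refl hc')

theorem iterate (h : Reach P w t c c') :
    (step P)^[t] c = c' ∧ ∀ r ≤ t, Bounded w ((step P)^[r] c) := by
  induction h with
  | refl hb =>
    refine ⟨rfl, fun r hr => ?_⟩
    obtain rfl : r = 0 := by omega
    exact hb
  | head hb _ ih =>
    refine ⟨ih.1, fun r hr => ?_⟩
    cases r with
    | zero => exact hb
    | succ r => exact ih.2 r (by omega)

end Reach

/-- The instructions of a list stand in the program from position `l` on. -/
def Placed (P : Program) : ℕ → List Instr → Prop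
  | _, [] => True
  | l, i :: code => P[l]? = some i ∧ Placed P (l + 1) code

theorem placed_append {P : Program} {l : ℕ} {code code' : List Instr} :
    Placed P l (code ++ code') ↔ Placed P l code ∧ Placed P (l + code.length) code' := by
  induction code generalizing l with
  | nil => simp [Placed]
  | cons i code ih => simp [Placed, ih, and_assoc, Nat.add_assoc, Nat.add_comm 1]

theorem placed_self (pre code post : List Instr) :
    Placed (pre ++ code ++ post) pre.length code := by
  induction code generalizing pre with
  | nil => trivial
  | cons i code ih =>
    refine ⟨by simp, ?_⟩
    have := ih (pre ++ [i])
    simpa using this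

/-- Names of variables. -/
inductive Var where
  | out | numV | numE | blocks | addr | idx | len | free | bucket | top | best | time | edge | card | endAddr
  | last | vertex | cover | addr' | endAddr' | nbr | flag
deriving DecidableEq

/-- Names of arrays. -/
inductive Arr where
  | inp | off | sel | cnt | cov | size | head | ent | nxt
deriving DecidableEq

theorem Var.ctorIdx_injective : Function.Injective Var.ctorIdx :=
  Function.LeftInverse.injective Var.ofNat_ctorIdx

theorem Arr.ctorIdx_injective : Function.Injective Arr.ctorIdx :=
  Function.LeftInverse.injective Arr.ofNat_ctorIdx

/-- The values of the variables and the contents of the arrays. -/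
structure State where
  r : Var → ℕ
  a : Arr → ℕ → ℕ

/-- Assignments. -/
inductive Op where
  | const (d : Var) (k : ℕ)
  | add (d a b : Var)
  | addc (d a : Var) (k : ℕ)
  | subc (d a : Var) (k : ℕ)
  | ld (d : Var) (j : Arr) (a : Var)
  | st (j : Arr) (a b : Var)

/-- Conditions. -/
inductive Cond where
  | lt (a b : Var)
  | eq (a b : Var)
  | pos (a : Var)

/-- Structured programs. -/
inductive Cmd where
  | skip
  | op (o : Op)
  | seq (c d : Cmd)
  | ite (b : Cond) (c d : Cmd)
  | loop (b : Cond) (c : Cmd)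

/-- The register of a variable. Register `1` is for intermediate results. -/
def Var.reg (x : Var) : ℕ := 2 * x.ctorIdx

/-- The register that holds the address of the first element of an array. -/
def Arr.reg (j : Arr) : ℕ := 2 * j.ctorIdx + 3

def Op.exec (s : State) : Op → State
  | const d k => ⟨Function.update s.r d k, s.a⟩
  | add d a b => ⟨Function.update s.r d (s.r a + s.r b), s.a⟩
  | addc d a k => ⟨Function.update s.r d (s.r a + k), s.a⟩
  | subc d a k => ⟨Function.update s.r d (s.r a - k), s.a⟩
  | ld d j a => ⟨Function.update s.r d (s.a j (s.r a)), s.a⟩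
  | st j a b => ⟨s.r, Function.update s.a j (Function.update (s.a j) (s.r a) (s.r b))⟩

/-- With `K` arrays of size `D` and words up to `w`, the assignment neither overflows nor leaves
an array. -/
def Op.Safe (K D w : ℕ) (s : State) : Op → Prop
  | const _ k => k ≤ w
  | add _ a b => s.r a + s.r b ≤ w
  | addc _ a k => s.r a + k ≤ w
  | subc _ _ k => k ≤ w
  | ld _ j a => j.ctorIdx < K ∧ s.r a < D
  | st j a _ => j.ctorIdx < K ∧ s.r a < D

def Op.code : Op → List Instr
  | const d k => [.const 1 k, .move d.reg 1]
  | add d a b => [.add 1 a.reg b.reg, .move d.reg 1]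
  | addc d a k => [.const 1 k, .add d.reg a.reg 1]
  | subc d a k => [.const 1 k, .sub d.reg a.reg 1]
  | ld d j a => [.add 1 j.reg a.reg, .load d.reg 1]
  | st j a b => [.add 1 j.reg a.reg, .store 1 b.reg]

def Cond.Holds (s : State) : Cond → Prop
  | lt a b => s.r a < s.r b
  | eq a b => s.r a = s.r b
  | pos a => 0 < s.r a

/-- Code that jumps to `l` if the condition holds. -/
def Cond.code (l : ℕ) : Cond → List Instr
  | lt a b => [.const 1 0, .jumpLt a.reg b.reg l]
  | eq a b => [.const 1 0, .jumpEq a.reg b.reg l]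
  | pos a => [.const 1 0, .jumpLt 1 a.reg l]

/-- The length of the compiled program. -/
def Cmd.len : Cmd → ℕ
  | skip => 0
  | op _ => 2
  | seq c d => c.len + d.len
  | ite _ c d => d.len + c.len + 3
  | .loop _ c => c.len + 4

/-- The program as it is to be placed at position `l`. -/
def Cmd.compile (l : ℕ) : Cmd → List Instr
  | skip => []
  | op o => o.code
  | seq c d => c.compile l ++ d.compile (l + c.len)
  | ite b c d => b.code (l + 2 + d.len + 1) ++ (d.compile (l + 2) ++
      (.jump (l + 2 + d.len + 1 + c.len) :: c.compile (l + 2 + d.len + 1)))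
  | .loop b c => b.code (l + 2 + 1) ++ (.jump (l + 2 + 1 + c.len + 1) ::
      (c.compile (l + 2 + 1) ++ [.jump l]))

@[simp] theorem Op.length_code (o : Op) : o.code.length = 2 := by
  cases o <;> rfl

@[simp] theorem Cond.length_code (l : ℕ) (b : Cond) : (b.code l).length = 2 := by
  cases b <;> rfl

@[simp] theorem Cmd.length_compile (l : ℕ) (c : Cmd) : (c.compile l).length = c.len := by
  induction c generalizing l with
  | skip => rfl
  | op o => simp [compile, len]
  | seq c d hc hd => simp [compile, len, hc, hd]
  | ite b c d hc hd => simp [compile, len, hc, hd]; omega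
  | loop b c hc => simp [compile, len, hc]; omega

/-- The machine represents the state, with `K` arrays of size `D` and words up to `w`. -/
structure Represents (K D w : ℕ) (c : Config) (s : State) : Prop where
  var : ∀ x : Var, c.reg x.reg = s.r x
  base : ∀ j < K, c.reg (2 * j + 3) = j * D
  arr : ∀ j : Arr, j.ctorIdx < K → ∀ i < D, c.mem (j.ctorIdx * D + i) = s.a j i
  zero : ∀ i, K * D ≤ i → c.mem i = 0
  bounded : Bounded w c
  size : K * D ≤ w

namespace Represents

variable {K D w pc pc' : ℕ} {reg mem : ℕ → ℕ} {s : State}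

theorem update_tmp (h : Represents K D w ⟨pc, reg, mem⟩ s) {k : ℕ} (hk : k ≤ w) :
    Represents K D w ⟨pc', Function.update reg 1 k, mem⟩ s where
  var x := by
    have h0 := h.var x
    dsimp only at h0 ⊢
    rwa [Function.update_of_ne (by rw [Var.reg]; omega)]
  base j hj := by
    have h0 := h.base j hj
    dsimp only at h0 ⊢
    rwa [Function.update_of_ne (by omega)]
  arr := h.arr
  zero := h.zero
  bounded := h.bounded.update_reg hk
  size := h.size

theorem update_var (h : Represents K D w ⟨pc, reg, mem⟩ s) {k : ℕ} (hk : k ≤ w) (d : Var) :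
    Represents K D w ⟨pc', Function.update reg d.reg k, mem⟩ ⟨Function.update s.r d k, s.a⟩ where
  var x := by
    by_cases hx : x = d
    · simp [hx]
    · have h1 : x.reg ≠ d.reg := fun h' => hx (Var.ctorIdx_injective (by
        simp only [Var.reg] at h'
        omega))
      simpa [hx, h1] using h.var x
  base j hj := by
    have h0 := h.base j hj
    dsimp only at h0 ⊢
    rwa [Function.update_of_ne (by rw [Var.reg]; omega)]
  arr := h.arr
  zero := h.zero
  bounded := h.bounded.update_reg hk
  size := h.size

theorem add_mul_lt {j i : ℕ} (hj : j < K) (hi : i < D) : j * D + i < K * D := by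
  have : (j + 1) * D ≤ K * D := Nat.mul_le_mul_right D hj
  rw [Nat.add_mul] at this
  omega

theorem update_arr (h : Represents K D w ⟨pc, reg, mem⟩ s) {k : ℕ} (hk : k ≤ w) {j : Arr}
    (hj : j.ctorIdx < K) {i : ℕ} (hi : i < D) :
    Represents K D w ⟨pc', reg, Function.update mem (j.ctorIdx * D + i) k⟩
      ⟨s.r, Function.update s.a j (Function.update (s.a j) i k)⟩ where
  var := h.var
  base := h.base
  arr j' hj' i' hi' := by
    have h0 := h.arr j' hj' i' hi'
    dsimp only at h0 ⊢
    by_cases hjj : j' = j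
    · subst hjj
      by_cases hii : i' = i
      · simp [hii]
      · simp [hii, h0]
    · have h1 : j'.ctorIdx * D + i' ≠ j.ctorIdx * D + i := by
        intro heq
        apply hjj
        apply Arr.ctorIdx_injective
        rcases lt_trichotomy j'.ctorIdx j.ctorIdx with hlt | heq' | hlt
        · have := add_mul_lt hlt hi'
          omega
        · exact heq'
        · have := add_mul_lt hlt hi
          omega
      simp [hjj, h1, h0]
  zero i' hi' := by
    have h0 := h.zero i' hi'
    have := add_mul_lt hj hi
    dsimp only at h0 ⊢
    rw [Function.update_of_ne (by omega), h0]
  bounded := h.bounded.update_mem hk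
  size := h.size

theorem var_le {c : Config} (h : Represents K D w c s) (x : Var) : s.r x ≤ w :=
  h.var x ▸ (h.bounded _).1

theorem arr_le {c : Config} (h : Represents K D w c s) {j : Arr} (hj : j.ctorIdx < K) {i : ℕ}
    (hi : i < D) : s.a j i ≤ w :=
  h.arr j hj i hi ▸ (h.bounded _).2

theorem with_pc {c : Config} (h : Represents K D w c s) (pc : ℕ) :
    Represents K D w ⟨pc, c.reg, c.mem⟩ s :=
  ⟨h.var, h.base, h.arr, h.zero, h.bounded, h.size⟩

end Represents

/-- Started in the state `s`, the compiled command terminates after some number `t` of steps in a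
state `s'` such that `Q t s'`. -/
def Cmd.Ensures (K D w : ℕ) (c : Cmd) (s : State) (Q : ℕ → State → Prop) : Prop :=
  ∀ (P : Program) (l : ℕ), Placed P l (c.compile l) →
    ∀ conf : Config, conf.pc = l → Represents K D w conf s →
      ∃ t conf' s', Reach P w t conf conf' ∧ conf'.pc = l + c.len ∧ Represents K D w conf' s' ∧
        Q t s'

theorem Op.reach {K D w : ℕ} {o : Op} {s : State} (hs : o.Safe K D w s) {P : Program} {l : ℕ}
    (hP : Placed P l o.code) {conf : Config} (hpc : conf.pc = l)
    (hr : Represents K D w conf s) :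
    ∃ conf', Reach P w 2 conf conf' ∧ conf'.pc = l + 2 ∧ Represents K D w conf' (o.exec s) := by
  obtain ⟨pc, reg, mem⟩ := conf
  obtain rfl : pc = l := hpc
  have key : ∀ (i₁ i₂ : Instr) (k : ℕ), o.code = [i₁, i₂] → k ≤ w →
      i₁.exec ⟨pc, reg, mem⟩ = ⟨pc + 1, Function.update reg 1 k, mem⟩ →
      (i₂.exec ⟨pc + 1, Function.update reg 1 k, mem⟩).pc = pc + 2 →
      Represents K D w (i₂.exec ⟨pc + 1, Function.update reg 1 k, mem⟩) (o.exec s) →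
      ∃ conf', Reach P w 2 ⟨pc, reg, mem⟩ conf' ∧ conf'.pc = pc + 2 ∧
        Represents K D w conf' (o.exec s) := by
    intro i₁ i₂ k hc hk h₁ hpc' h₂
    rw [hc] at hP
    have hb := hr.bounded.update_reg (d := 1) (pc' := pc + 1) hk
    have hr₁ := Reach.of_exec (c := ⟨pc, reg, mem⟩) (w := w) hP.1 hr.bounded (h₁ ▸ hb)
    rw [h₁] at hr₁
    have hr₂ := Reach.of_exec (c := ⟨pc + 1, Function.update reg 1 k, mem⟩) hP.2.1 hb h₂.bounded
    exact ⟨_, hr₁.trans hr₂, hpc', h₂⟩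
  have hv : ∀ (x : Var) (k : ℕ), Function.update reg 1 k x.reg = s.r x := fun x k => by
    rw [Function.update_of_ne (by rw [Var.reg]; omega)]
    exact hr.var x
  cases o with
  | const d k =>
    refine key _ _ k rfl hs rfl rfl ?_
    simpa [Instr.exec, exec] using (hr.update_tmp (pc' := pc + 1) hs).update_var hs d
  | add d a b =>
    have hva := hr.var a
    have hvb := hr.var b
    dsimp only at hva hvb
    refine key _ _ (s.r a + s.r b) rfl hs (by simp [Instr.exec, hva, hvb]) rfl ?_
    simpa [Instr.exec, exec] using (hr.update_tmp (pc' := pc + 1) hs).update_var hs d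
  | addc d a k =>
    have hk : k ≤ w := le_trans (Nat.le_add_left _ _) hs
    refine key _ _ k rfl hk rfl rfl ?_
    simpa [Instr.exec, exec, hv] using (hr.update_tmp (pc' := pc + 1) hk).update_var hs d
  | subc d a k =>
    refine key _ _ k rfl hs rfl rfl ?_
    have := (hr.update_tmp (pc' := pc + 1) hs).update_var (pc' := pc + 2)
      ((Nat.sub_le _ k).trans (hr.var_le a)) d
    simpa [Instr.exec, exec, hv] using this
  | ld d j a =>
    have hva := hr.var a
    have hbj : reg j.reg = j.ctorIdx * D := hr.base _ hs.1
    have hm := hr.arr j hs.1 _ hs.2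
    dsimp only at hva hm
    have hk : j.ctorIdx * D + s.r a ≤ w := (Represents.add_mul_lt hs.1 hs.2).le.trans hr.size
    refine key _ _ _ rfl hk (by simp [Instr.exec, hva, hbj]) rfl ?_
    have := (hr.update_tmp (pc' := pc + 1) hk).update_var (pc' := pc + 2) (hr.arr_le hs.1 hs.2) d
    simpa [Instr.exec, exec, hm] using this
  | st j a b =>
    have hva := hr.var a
    have hbj : reg j.reg = j.ctorIdx * D := hr.base _ hs.1
    dsimp only at hva
    have hk : j.ctorIdx * D + s.r a ≤ w := (Represents.add_mul_lt hs.1 hs.2).le.trans hr.size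
    refine key _ _ _ rfl hk (by simp [Instr.exec, hva, hbj]) rfl ?_
    have := (hr.update_tmp (pc' := pc + 1) hk).update_arr (pc' := pc + 2) (hr.var_le b) hs.1 hs.2
    simpa [Instr.exec, exec, hv] using this

open Classical in
theorem Cond.reach {K D w : ℕ} {b : Cond} {s : State} {P : Program} {l l' : ℕ}
    (hP : Placed P l (b.code l')) {conf : Config} (hpc : conf.pc = l)
    (hr : Represents K D w conf s) :
    ∃ conf', Reach P w 2 conf conf' ∧ conf'.pc = (if b.Holds s then l' else l + 2) ∧
      Represents K D w conf' s := by
  obtain ⟨pc, reg, mem⟩ := conf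
  obtain rfl : pc = l := hpc
  have key : ∀ i : Instr, b.code l' = [.const 1 0, i] →
      i.exec ⟨pc + 1, Function.update reg 1 0, mem⟩ =
        ⟨if b.Holds s then l' else pc + 2, Function.update reg 1 0, mem⟩ →
      ∃ conf', Reach P w 2 ⟨pc, reg, mem⟩ conf' ∧
        conf'.pc = (if b.Holds s then l' else pc + 2) ∧ Represents K D w conf' s := by
    intro i hc he
    rw [hc] at hP
    have h₁ := hr.update_tmp (pc' := pc + 1) (Nat.zero_le w)
    have h₂ := hr.update_tmp (pc' := if b.Holds s then l' else pc + 2) (Nat.zero_le w)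
    have hr₁ := Reach.of_exec (c := ⟨pc, reg, mem⟩) hP.1 hr.bounded h₁.bounded
    have hr₂ := Reach.of_exec (c := ⟨pc + 1, Function.update reg 1 0, mem⟩) hP.2.1 h₁.bounded
      (he ▸ h₂.bounded)
    rw [he] at hr₂
    exact ⟨_, hr₁.trans hr₂, rfl, h₂⟩
  have hv : ∀ x : Var, Function.update reg 1 0 x.reg = s.r x := fun x => by
    rw [Function.update_of_ne (by rw [Var.reg]; omega)]
    exact hr.var x
  cases b with
  | lt a b => exact key _ rfl (by simp [Instr.exec, Holds, hv, Nat.add_assoc]; congr)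
  | eq a b => exact key _ rfl (by simp [Instr.exec, Holds, hv, Nat.add_assoc]; congr)
  | pos a => exact key _ rfl (by simp [Instr.exec, Holds, hv, Nat.add_assoc]; congr)

theorem Represents.reach_jump {K D w : ℕ} {s : State} {P : Program} {l l' : ℕ}
    (hP : P[l]? = some (.jump l')) {conf : Config} (hpc : conf.pc = l)
    (hr : Represents K D w conf s) :
    ∃ conf', Reach P w 1 conf conf' ∧ conf'.pc = l' ∧ Represents K D w conf' s := by
  subst hpc
  exact ⟨_, Reach.of_exec hP hr.bounded (hr.with_pc l').bounded, rfl, hr.with_pc l'⟩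

namespace Cmd.Ensures

variable {K D w : ℕ} {c d : Cmd} {b : Cond} {s : State} {Q R : ℕ → State → Prop}

theorem mono (h : c.Ensures K D w s Q) (hQR : ∀ t s', Q t s' → R t s') :
    c.Ensures K D w s R := by
  intro P l hP conf hpc hr
  obtain ⟨t, conf', s', h1, h2, h3, h4⟩ := h P l hP conf hpc hr
  exact ⟨t, conf', s', h1, h2, h3, hQR t s' h4⟩

theorem skip (h : Q 0 s) : Cmd.skip.Ensures K D w s Q :=
  fun _ _ _ conf hpc hr => ⟨0, conf, s, .refl hr.bounded, hpc, hr, h⟩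

theorem op {o : Op} (hs : o.Safe K D w s) (h : Q 2 (o.exec s)) :
    (Cmd.op o).Ensures K D w s Q := by
  intro P l hP conf hpc hr
  obtain ⟨conf', h1, h2, h3⟩ := Op.reach hs hP hpc hr
  exact ⟨2, conf', _, h1, h2, h3, h⟩

theorem seq (h : c.Ensures K D w s fun t s' => d.Ensures K D w s' fun t' => Q (t + t')) :
    (Cmd.seq c d).Ensures K D w s Q := by
  intro P l hP conf hpc hr
  obtain ⟨hPc, hPd⟩ := placed_append.mp hP
  rw [length_compile] at hPd
  obtain ⟨t, conf', s', h1, h2, h3, h4⟩ := h P l hPc conf hpc hr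
  obtain ⟨t', conf'', s'', h1', h2', h3', h4'⟩ := h4 P _ hPd conf' h2 h3
  exact ⟨_, conf'', s'', h1.trans h1', by rw [h2', len, Nat.add_assoc], h3', h4'⟩

theorem ite (h₁ : b.Holds s → c.Ensures K D w s fun t => Q (t + 2))
    (h₂ : ¬ b.Holds s → d.Ensures K D w s fun t => Q (t + 3)) :
    (Cmd.ite b c d).Ensures K D w s Q := by
  intro P l hP conf hpc hr
  obtain ⟨hPb, hP⟩ := placed_append.mp hP
  obtain ⟨hPd, hPj, hPc⟩ := placed_append.mp hP
  rw [Cond.length_code] at hPd hPj hPc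
  rw [length_compile] at hPj hPc
  obtain ⟨conf', g1, g2, g3⟩ := Cond.reach hPb hpc hr
  by_cases hb : b.Holds s
  · rw [if_pos hb] at g2
    obtain ⟨t, conf'', s', k1, k2, k3, k4⟩ := h₁ hb P _ hPc conf' g2 g3
    refine ⟨_, conf'', s', g1.trans k1, by rw [k2, len]; omega, k3, ?_⟩
    rwa [Nat.add_comm 2 t]
  · rw [if_neg hb] at g2
    obtain ⟨t, conf'', s', k1, k2, k3, k4⟩ := h₂ hb P _ hPd conf' g2 g3
    obtain ⟨conf₃, m1, m2, m3⟩ := k3.reach_jump hPj k2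
    refine ⟨_, conf₃, s', (g1.trans k1).trans m1, by rw [m2, len]; omega, m3, ?_⟩
    rwa [show 2 + t + 1 = t + 3 by omega]

theorem loop_done (hb : ¬ b.Holds s) (h : Q 3 s) : (Cmd.loop b c).Ensures K D w s Q := by
  intro P l hP conf hpc hr
  obtain ⟨hPb, hPj, hP⟩ := placed_append.mp hP
  rw [Cond.length_code] at hPj
  obtain ⟨conf', g1, g2, g3⟩ := Cond.reach hPb hpc hr
  rw [if_neg hb] at g2
  obtain ⟨conf₃, m1, m2, m3⟩ := g3.reach_jump hPj g2
  exact ⟨_, conf₃, s, g1.trans m1, by rw [m2, len]; omega, m3, h⟩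

theorem loop_step (hb : b.Holds s)
    (h : c.Ensures K D w s fun t s' =>
      (Cmd.loop b c).Ensures K D w s' fun t' => Q (t + t' + 3)) :
    (Cmd.loop b c).Ensures K D w s Q := by
  intro P l hP conf hpc hr
  have hPw := hP
  obtain ⟨hPb, hPj, hP⟩ := placed_append.mp hP
  obtain ⟨hPc, hPe, -⟩ := placed_append.mp hP
  rw [Cond.length_code] at hPc hPe
  rw [length_compile] at hPe
  obtain ⟨conf', g1, g2, g3⟩ := Cond.reach hPb hpc hr
  rw [if_pos hb] at g2
  obtain ⟨t, conf'', s', k1, k2, k3, k4⟩ := h P _ hPc conf' g2 g3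
  obtain ⟨conf₃, m1, m2, m3⟩ := k3.reach_jump hPe k2
  obtain ⟨t', conf₄, s'', n1, n2, n3, n4⟩ := k4 P l hPw conf₃ m2 m3
  refine ⟨_, conf₄, s'', ((g1.trans k1).trans m1).trans n1, n2, n3, ?_⟩
  rwa [show 2 + t + 1 + t' = t + t' + 3 by omega]

/-- Loops with an invariant `I N`, where the potential `N` pays for the steps. -/
theorem loop_of_invariant {I : ℕ → State → Prop}
    (hI : ∀ N s, I N s → b.Holds s →
      c.Ensures K D w s fun t s' => ∃ N', I N' s' ∧ t + 3 + N' ≤ N)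
    {N : ℕ} (hs : I N s) :
    (Cmd.loop b c).Ensures K D w s fun t s' =>
      ∃ N', I N' s' ∧ ¬ b.Holds s' ∧ t + N' ≤ N + 3 := by
  induction N using Nat.strong_induction_on generalizing s with
  | _ N ih =>
    by_cases hb : b.Holds s
    · refine loop_step hb ((hI N s hs hb).mono fun t s' ⟨N', hs', ht⟩ => ?_)
      refine (ih N' (by omega) hs').mono fun t' s'' ⟨N'', h1, h2, h3⟩ => ⟨N'', h1, h2, ?_⟩
      omega
    · exact loop_done hb ⟨N, hs, hb, by omega⟩

end Cmd.Ensures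

/-! ### Straight-line code and loops over lists -/

/-- A sequence of assignments. -/
def Cmd.block : List Op → Cmd
  | [] => .skip
  | o :: os => .seq (.op o) (block os)

def execAll (s : State) : List Op → State
  | [] => s
  | o :: os => execAll (o.exec s) os

def SafeAll (K D w : ℕ) (s : State) : List Op → Prop
  | [] => True
  | o :: os => o.Safe K D w s ∧ SafeAll K D w (o.exec s) os

theorem Cmd.Ensures.block {K D w : ℕ} {os : List Op} {s : State} {Q : ℕ → State → Prop}
    (hs : SafeAll K D w s os) (h : Q (2 * os.length) (execAll s os)) :
    (Cmd.block os).Ensures K D w s Q := by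
  induction os generalizing s Q with
  | nil => exact .skip h
  | cons o os ih =>
    refine .seq (.op hs.1 (ih hs.2 ?_))
    rwa [List.length_cons, Nat.mul_add, Nat.add_comm] at h

/-- Run through a list: `ptr` is the address before its first and `lim` that of its last
element. -/
def Cmd.forEach (ptr lim x : Var) (c : Cmd) : Cmd :=
  .loop (.lt ptr lim) ((Cmd.block [.addc ptr ptr 1, .ld x .inp ptr]).seq c)

/-- The elements of the list `xs` stand behind the address `o`. -/
def ElemsAt {k : ℕ} (D : ℕ) (inp : ℕ → ℕ) (o : ℕ) (xs : List (Fin k)) : Prop :=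
  o + xs.length < D ∧ ∀ i (hi : i < xs.length), inp (o + 1 + i) = xs[i]

theorem Cmd.Ensures.forEach {K D w k : ℕ} (hK : 0 < K) (hDw : D ≤ w) {ptr lim x : Var} {c : Cmd} {xs : List (Fin k)} {o : ℕ}
    (I : List (Fin k) → ℕ → State → Prop) {s : State} (hxs : ElemsAt D (s.a .inp) o xs)
    (hptr : s.r ptr = o) (hlim : s.r lim = o + xs.length) (hI : I [] 0 s)
    (hstep : ∀ (done : List (Fin k)) (y : Fin k) (rest : List (Fin k)) t s', xs = done ++ y :: rest → I done t s' →
      c.Ensures K D w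
        ⟨Function.update (Function.update s'.r ptr (o + done.length + 1)) x y, s'.a⟩
        fun t' s'' => I (done ++ [y]) (t + t' + 7) s'' ∧ s''.r ptr = o + done.length + 1 ∧
          s''.r lim = s'.r lim ∧ s''.a .inp = s'.a .inp) :
    (Cmd.forEach ptr lim x c).Ensures K D w s fun t s' => ∃ t', t = t' + 3 ∧ I xs t' s' := by
  suffices h : ∀ (rest done : List (Fin k)) (t : ℕ) (s' : State), xs = done ++ rest →
      I done t s' → s'.r ptr = o + done.length → s'.r lim = o + xs.length →
      s'.a .inp = s.a .inp →
      (Cmd.forEach ptr lim x c).Ensures K D w s' fun t' s'' =>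
        ∃ t'', t + t' = t'' + 3 ∧ I xs t'' s'' by
    refine (h xs [] 0 s (by simp) hI (by simpa using hptr) hlim rfl).mono ?_
    rintro t s' ⟨t', ht, h⟩
    exact ⟨t', by omega, h⟩
  intro rest
  induction rest with
  | nil =>
    intro done t s' hd hI' ha hs _
    rw [List.append_nil] at hd
    subst hd
    exact .loop_done (by simp [Cond.Holds, ha, hs]) ⟨t, rfl, hI'⟩
  | cons y rest ih =>
    intro done t s' hd hI' ha hs hinp
    have hlen : xs.length = done.length + (rest.length + 1) := by simp [hd]
    have hy : s.a .inp (o + done.length + 1) = y := by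
      have := hxs.2 done.length (by omega)
      rw [show o + done.length + 1 = o + 1 + done.length by omega, this]
      simp [hd]
    have hlt := hxs.1
    refine .loop_step (by simp [Cond.Holds, ha, hs, hlen]) (.seq (.block ?_ ?_))
    · simp only [SafeAll, Op.Safe, Op.exec, Function.update_self, ha, Arr.ctorIdx]
      refine ⟨by omega, ⟨hK, by omega⟩, trivial⟩
    · have heq : execAll s' [.addc ptr ptr 1, .ld x .inp ptr] =
          ⟨Function.update (Function.update s'.r ptr (o + done.length + 1)) x y, s'.a⟩ := by
        simp [execAll, Op.exec, ha, hinp, hy]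
      rw [heq]
      refine (hstep done y rest t s' hd hI').mono ?_
      rintro t' s'' ⟨hI'', ha'', hs'', hinp''⟩
      refine (ih (done ++ [y]) _ s'' (by simp [hd]) hI'' ?_ (hs''.trans hs)
        (hinp''.trans hinp)).mono ?_
      · rw [ha'']
        simp [Nat.add_assoc]
      · rintro t₁ s₁ ⟨t₂, ht, h⟩
        exact ⟨t₂, by simp only [List.length_cons, List.length_nil]; omega, h⟩

/-! ### Buckets of hyperedges -/

section Queue

variable {m : ℕ}

/-- `L` is the linked list that starts with the entry `p`. -/
def Chain (a : Arr → ℕ → ℕ) (free : ℕ) : ℕ → List (Fin m) → Prop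
  | p, [] => p = 0
  | p, e :: L => 0 < p ∧ p ≤ free ∧ a .ent p = e ∧ Chain a free (a .nxt p) L

theorem Chain.mono {a a' : Arr → ℕ → ℕ} {free free' p : ℕ} {L : List (Fin m)}
    (h : Chain a free p L) (hf : free ≤ free') (he : ∀ p ≤ free, a' .ent p = a .ent p)
    (hn : ∀ p ≤ free, a' .nxt p = a .nxt p) : Chain a' free' p L := by
  induction L generalizing p with
  | nil => exact h
  | cons e L ih =>
    obtain ⟨h1, h2, h3, h4⟩ := h
    refine ⟨h1, h2.trans hf, (he p h2).trans h3, ?_⟩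
    rw [hn p h2]
    exact ih h4

/-- The buckets are linked lists. Bucket `y` holds hyperedges `e` with counter at least `y - 1`, and
each hyperedge with the property `Q` occurs in the bucket that belongs to its counter. Of the
entries allocated so far all but `pops` are still in use. -/
def Queue (D : ℕ) (Q : Fin m → Prop) (pops : ℕ) (a : Arr → ℕ → ℕ) (free : ℕ) : Prop :=
  ∃ B : ℕ → List (Fin m), (∀ y, Chain a free (a .head y) (B y)) ∧
    (∀ y, ∀ e ∈ B y, y ≤ a .cnt e + 1) ∧ (∀ e, Q e → e ∈ B (a .cnt e + 1)) ∧
    (∀ y, D ≤ y → B y = []) ∧ ∑ y ∈ Finset.range D, (B y).length + pops = free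

variable {D pops free : ℕ} {Q : Fin m → Prop} {a : Arr → ℕ → ℕ}

theorem Queue.congr {a' : Arr → ℕ → ℕ} (h : Queue D Q pops a free)
    (h₁ : a' .head = a .head) (h₂ : a' .ent = a .ent) (h₃ : a' .nxt = a .nxt)
    (h₄ : a' .cnt = a .cnt) : Queue D Q pops a' free := by
  obtain ⟨B, hB, h⟩ := h
  refine ⟨B, fun y => ?_, ?_⟩
  · rw [h₁]
    exact (hB y).mono le_rfl (by simp [h₂]) (by simp [h₃])
  · rwa [h₄]

theorem Queue.imp {Q' : Fin m → Prop} (h : Queue D Q pops a free) (hQ : ∀ e, Q' e → Q e) :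
    Queue D Q' pops a free := by
  obtain ⟨B, h1, h2, h3, h4⟩ := h
  exact ⟨B, h1, h2, fun e he => h3 e (hQ e he), h4⟩

theorem Queue.pops_le (h : Queue D Q pops a free) : pops ≤ free := by
  obtain ⟨B, -, -, -, -, h⟩ := h
  omega

theorem queue_empty {a : Arr → ℕ → ℕ} (h : ∀ y, a .head y = 0) :
    Queue D (fun _ : Fin m => False) 0 a 0 :=
  ⟨fun _ => [], fun y => h y, by simp, by simp, by simp, by simp⟩

theorem sum_length_update (B : ℕ → List (Fin m)) {y : ℕ} (hy : y < D) (L : List (Fin m)) :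
    ∑ z ∈ Finset.range D, (Function.update B y L z).length + (B y).length =
      ∑ z ∈ Finset.range D, (B z).length + L.length := by
  rw [← Finset.add_sum_erase _ _ (Finset.mem_range.mpr hy),
    ← Finset.add_sum_erase (a := y) _ (fun z => (B z).length) (Finset.mem_range.mpr hy),
    Finset.sum_congr rfl (g := fun z => (B z).length)]
  · simp only [Function.update_self]
    omega
  · intro z hz
    simp [Finset.ne_of_mem_erase hz]

theorem Queue.push {a' : Arr → ℕ → ℕ} (h : Queue D Q pops a free) {f : Fin m} {y : ℕ}
    (hy : y < D) (hyf : y ≤ a .cnt f + 1) (hc : a' .cnt = a .cnt)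
    (he : a' .ent = Function.update (a .ent) (free + 1) f)
    (hn : a' .nxt = Function.update (a .nxt) (free + 1) (a .head y))
    (hh : a' .head = Function.update (a .head) y (free + 1)) :
    Queue D (fun e => Q e ∨ (e = f ∧ y = a .cnt f + 1)) pops a' (free + 1) := by
  obtain ⟨B, h1, h2, h3, h4, h5⟩ := h
  have hch : ∀ {p L}, Chain (m := m) a free p L → Chain a' (free + 1) p L := fun h =>
    h.mono (Nat.le_succ _)
      (fun p hp => by rw [he, Function.update_of_ne (by omega)])
      (fun p hp => by rw [hn, Function.update_of_ne (by omega)])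
  have hmem : ∀ {z e}, e ∈ B z → e ∈ Function.update B y (f :: B y) z := by
    intro z e hz
    by_cases hzy : z = y
    · subst hzy
      simp [hz]
    · simpa [hzy] using hz
  refine ⟨Function.update B y (f :: B y), fun z => ?_, fun z e hz => ?_, fun e hq => ?_,
    fun z hz => ?_, ?_⟩
  · by_cases hzy : z = y
    · subst hzy
      rw [hh, Function.update_self, Function.update_self]
      refine ⟨by omega, le_rfl, by simp [he], ?_⟩
      rw [hn, Function.update_self]
      exact hch (h1 z)
    · rw [hh, Function.update_of_ne hzy, Function.update_of_ne hzy]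
      exact hch (h1 z)
  · rw [hc]
    by_cases hzy : z = y
    · subst hzy
      rw [Function.update_self] at hz
      rcases List.mem_cons.mp hz with rfl | hz
      · exact hyf
      · exact h2 z e hz
    · rw [Function.update_of_ne hzy] at hz
      exact h2 z e hz
  · rw [hc]
    rcases hq with hq | ⟨rfl, rfl⟩
    · exact hmem (h3 e hq)
    · simp
  · rw [Function.update_of_ne (by omega)]
    exact h4 z hz
  · have := sum_length_update B hy (f :: B y)
    simp only [List.length_cons] at this
    omega

/-- Taking the first hyperedge out of a bucket. -/
theorem Queue.pop (h : Queue D Q pops a free) {y : ℕ} (hy : y < D) (hpos : 0 < a .head y) :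
    ∃ e : Fin m, a .head y ≤ free ∧ a .ent (a .head y) = e ∧ y ≤ a .cnt e + 1 ∧
      ∀ a' : Arr → ℕ → ℕ, a' .cnt = a .cnt → a' .ent = a .ent → a' .nxt = a .nxt →
        a' .head = Function.update (a .head) y (a .nxt (a .head y)) →
        Queue D (fun e' => Q e' ∧ e' ≠ e) (pops + 1) a' free := by
  obtain ⟨B, h1, h2, h3, h4, h5⟩ := h
  have hch := h1 y
  cases hB : B y with
  | nil =>
    rw [hB] at hch
    exact absurd hch hpos.ne'
  | cons e L =>
    rw [hB] at hch
    obtain ⟨-, hle, hent, hnxt⟩ := hch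
    refine ⟨e, hle, hent, h2 y e (by simp [hB]), fun a' hc he hn hh => ?_⟩
    have hch : ∀ {p L}, Chain (m := m) a free p L → Chain a' free p L := fun h =>
      h.mono le_rfl (by simp [he]) (by simp [hn])
    refine ⟨Function.update B y L, fun z => ?_, fun z e' hz => ?_, fun e' hq => ?_,
      fun z hz => ?_, ?_⟩
    · by_cases hzy : z = y
      · subst hzy
        rw [hh, Function.update_self, Function.update_self]
        exact hch hnxt
      · rw [hh, Function.update_of_ne hzy, Function.update_of_ne hzy]
        exact hch (h1 z)
    · rw [hc]
      by_cases hzy : z = y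
      · subst hzy
        rw [Function.update_self] at hz
        exact h2 z e' (by simp [hB, hz])
      · rw [Function.update_of_ne hzy] at hz
        exact h2 z e' hz
    · rw [hc]
      have := h3 e' hq.1
      by_cases hzy : a .cnt e' + 1 = y
      · rw [hzy, hB] at this
        rw [hzy, Function.update_self]
        exact (List.mem_cons.mp this).resolve_left hq.2
      · rwa [Function.update_of_ne hzy]
    · rw [Function.update_of_ne (by omega)]
      exact h4 z hz
    · have := sum_length_update B hy L
      rw [hB] at this
      simp only [List.length_cons] at this
      omega

theorem Queue.cnt_ne (h : Queue D Q pops a free) {y : ℕ} (h0 : a .head y = 0) {e : Fin m}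
    (he : Q e) : a .cnt e + 1 ≠ y := by
  obtain ⟨B, h1, h2, h3, -⟩ := h
  rintro rfl
  have hch := h1 (a .cnt e + 1)
  have hmem := h3 e he
  cases hB : B (a .cnt e + 1) with
  | nil => simp [hB] at hmem
  | cons e L =>
    rw [hB] at hch
    exact hch.1.ne' h0

end Queue

/-- Put the hyperedge `nbr` into the bucket `bucket`. -/
def pushOps : List Op :=
  [.addc .free .free 1, .st .ent .free .nbr, .ld .top .head .bucket, .st .nxt .free .top,
    .st .head .bucket .free]

/-- Increase the counter of the hyperedge `nbr`, and put it into the new bucket. -/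
def bumpOps : List Op :=
  [.ld .flag .cnt .nbr, .addc .flag .flag 1, .st .cnt .nbr .flag, .addc .bucket .flag 1] ++ pushOps

theorem ensures_bump {m D w pops : ℕ} {Q : Fin m → Prop} (hDw : 9 * D ≤ w) {s : State}
    (hq : Queue D Q pops s.a (s.r .free)) {f : Fin m} (hf : s.r .nbr = f) (hm : m < D)
    (hcnt : s.a .cnt f + 2 < D) (hfree : s.r .free + 1 < D) :
    (Cmd.block bumpOps).Ensures 9 D w s fun t s' => t = 18 ∧
      Queue D Q pops s'.a (s'.r .free) ∧ s'.r .free = s.r .free + 1 ∧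
      s'.a .cnt = Function.update (s.a .cnt) f (s.a .cnt f + 1) ∧
      (∀ x ∉ [.free, .top, .flag, .bucket], s'.r x = s.r x) ∧
      ∀ j ∉ [.cnt, .head, .ent, .nxt], s'.a j = s.a j := by
  have hfD := f.2.trans hm
  refine .block ?_ ⟨rfl, ?_, ?_, ?_, ?_, ?_⟩
  · simp [bumpOps, pushOps, SafeAll, Op.Safe, Op.exec, hf, Arr.ctorIdx]
    omega
  · have h1 : Queue D (fun e => Q e ∧ e ≠ f) pops
        (Function.update s.a .cnt (Function.update (s.a .cnt) f (s.a .cnt f + 1)))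
        (s.r .free) := by
      obtain ⟨B, h1, h2, h3, h4⟩ := hq
      refine ⟨B, fun y => ?_, fun y e he => ?_, fun e he => ?_, h4⟩
      · exact (h1 y).mono le_rfl (by simp) (by simp)
      · refine (h2 y e he).trans ?_
        simp only [Function.update_self, Function.update_apply]
        split_ifs with h <;> simp [h]
      · simpa [Function.update_apply, Fin.val_inj, he.2] using h3 e he.1
    refine (h1.push (f := f) (y := s.a .cnt f + 2) hcnt (by simp) (a' := _) ?_ ?_ ?_ ?_).imp ?_
    · simp [bumpOps, pushOps, execAll, Op.exec, hf]
    · simp [bumpOps, pushOps, execAll, Op.exec, hf]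
    · simp [bumpOps, pushOps, execAll, Op.exec, hf]
    · simp [bumpOps, pushOps, execAll, Op.exec, hf]
    · intro e he
      by_cases hef : e = f
      · exact Or.inr ⟨hef, by simp⟩
      · exact Or.inl ⟨he, hef⟩
  · simp [bumpOps, pushOps, execAll, Op.exec]
  · simp [bumpOps, pushOps, execAll, Op.exec, hf]
  · intro x hx
    simp only [List.mem_cons, not_or] at hx
    simp [bumpOps, pushOps, execAll, Op.exec, hx]
  · intro x hx
    simp only [List.mem_cons, not_or] at hx
    simp [bumpOps, pushOps, execAll, Op.exec, hx]

open IndexedHypergraph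

/-! ### Selecting a hyperedge -/

/-- Mark the vertex `vertex` and bump all hyperedges that contain it. -/
def markVertex : Cmd :=
  (Cmd.block [.st .cov .vertex .time, .ld .addr' .off .vertex, .ld .endAddr' .inp .addr',
    .add .endAddr' .addr' .endAddr']).seq (.forEach .addr' .endAddr' .nbr (.block bumpOps))

section Marking

variable {n m : ℕ} {H : IndexedHypergraph (Fin n) (Fin m)}

/-- The adjacency lists can be found through the table of their addresses. -/
structure Loaded (A : H.AdjacencyLists) (D : ℕ) (s : State) : Prop where
  numV : s.r .numV = n
  edgesAt : ∀ v : Fin n, ElemsAt D (s.a .inp) (s.a .off v) (A.edgesAt v) ∧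
    s.a .inp (s.a .off v) = (A.edgesAt v).length
  verticesOf : ∀ e : Fin m, ElemsAt D (s.a .inp) (s.a .off (n + e)) (A.verticesOf e) ∧
    s.a .inp (s.a .off (n + e)) = (A.verticesOf e).length

theorem Loaded.congr {A : H.AdjacencyLists} {D : ℕ} {s s' : State} (h : Loaded A D s)
    (h₁ : s'.r .numV = s.r .numV) (h₂ : s'.a .inp = s.a .inp) (h₃ : s'.a .off = s.a .off) :
    Loaded A D s' := by
  refine ⟨h₁.trans h.numV, ?_, ?_⟩ <;> rw [h₂, h₃]
  · exact h.edgesAt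
  · exact h.verticesOf

/-- The part of the state that is updated whenever a vertex is marked. -/
structure Marking (A : H.AdjacencyLists) (D : ℕ) (Q : Fin m → Prop) (pops : ℕ) (s : State) :
    Prop where
  loaded : Loaded A D s
  queue : Queue D Q pops s.a (s.r .free)
  counted : ∀ f : Fin m, s.a .cnt f = ((H.edge f).filter fun u : Fin n => s.a .cov (u : ℕ) ≠ 0).card
  budget : s.r .free + ∑ u ∈ Finset.univ.filter fun u : Fin n => s.a .cov (u : ℕ) = 0, (A.edgesAt u).length = m + H.totalSize

variable {A : H.AdjacencyLists} {D w pops : ℕ} {Q : Fin m → Prop}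

theorem Marking.congr {s s' : State} (h : Marking A D Q pops s)
    (hr : ∀ x ∈ [Var.numV, .free], s'.r x = s.r x)
    (ha : ∀ j ∈ [Arr.inp, .off, .cnt, .cov, .head, .ent, .nxt], s'.a j = s.a j) :
    Marking A D Q pops s' := by
  simp only [List.forall_mem_cons] at hr ha
  obtain ⟨r1, r2, -⟩ := hr
  obtain ⟨a1, a2, a3, a4, a5, a6, a7, -⟩ := ha
  refine ⟨h.loaded.congr r1 a1 a2, ?_, ?_, ?_⟩
  · rw [r2]
    exact h.queue.congr a5 a6 a7 a3
  · rw [a3, a4]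
    exact h.counted
  · rw [r2, a4]
    exact h.budget

theorem Marking.free_le {s : State} (h : Marking A D Q pops s) :
    s.r .free ≤ m + H.totalSize := by
  have := h.budget
  omega

theorem ensures_markVertex (hD : n + m + 2 * H.totalSize + 2 ≤ D) (hDw : 9 * D ≤ w) {s : State}
    (h : Marking A D Q pops s) {v : Fin n} (hv : s.r .vertex = v) (hcov : s.a .cov v = 0)
    (htime : s.r .time ≠ 0) :
    markVertex.Ensures 9 D w s fun t s' => Marking A D Q pops s' ∧
      t + 25 * s.r .free = 25 * s'.r .free + 11 ∧
      s'.a .cov = Function.update (s.a .cov) v (s.r .time) ∧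
      (∀ x ∉ [.free, .top, .flag, .bucket, .nbr, .addr', .endAddr'], s'.r x = s.r x) ∧
      ∀ j ∉ [.cov, .cnt, .head, .ent, .nxt], s'.a j = s.a j := by
  obtain ⟨⟨hmem, helems⟩, hlen⟩ := h.loaded.edgesAt v
  have hnodup := A.edgesAt_nodup v
  have hdeg : (A.edgesAt v).length ≤ ∑ u ∈ Finset.univ.filter fun u : Fin n => s.a .cov (u : ℕ) = 0, (A.edgesAt u).length :=
    Finset.single_le_sum (f := fun u => (A.edgesAt u).length) (fun _ _ => Nat.zero_le _)
      (by simpa using hcov)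
  have hbudget := h.budget
  have hvn := v.2
  refine .seq (.block ?_ ?_)
  · simp [SafeAll, Op.Safe, Op.exec, hv, hlen, Arr.ctorIdx]
    omega
  set s₁ := execAll s [.st .cov .vertex .time, .ld .addr' .off .vertex, .ld .endAddr' .inp .addr',
    .add .endAddr' .addr' .endAddr'] with hs₁
  have hcov₁ : s₁.a .cov = Function.update (s.a .cov) v (s.r .time) := by
    simp [hs₁, execAll, Op.exec, hv]
  have ha₁ : ∀ j ≠ Arr.cov, s₁.a j = s.a j := fun j hj => by
    simp [hs₁, execAll, Op.exec, hj]
  have hr₁ : ∀ x ∉ [Var.addr', .endAddr'], s₁.r x = s.r x := fun x hx => by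
    simp only [List.mem_cons, not_or] at hx
    simp [hs₁, execAll, Op.exec, hx]
  have hq₁ : Queue D Q pops s₁.a (s₁.r .free) := by
    rw [hr₁ _ (by simp)]
    exact h.queue.congr (ha₁ _ (by simp)) (ha₁ _ (by simp)) (ha₁ _ (by simp)) (ha₁ _ (by simp))
  refine (Cmd.Ensures.forEach (by omega) (by omega) (xs := A.edgesAt v) (o := s.a .off v)
    (fun done t s' => Queue D Q pops s'.a (s'.r .free) ∧ s'.r .free = s.r .free + done.length ∧
      (∀ f : Fin m, s'.a .cnt f = s.a .cnt f + done.count f) ∧ t = 25 * done.length ∧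
      (∀ x ∉ [.free, .top, .flag, .bucket, .nbr, .addr', .endAddr'], s'.r x = s.r x) ∧
      ∀ j ∉ [.cnt, .head, .ent, .nxt], s'.a j = s₁.a j) ?_ ?_ ?_ ?_ ?_).mono ?_
  · rw [ha₁ _ (by simp)]
    exact ⟨hmem, helems⟩
  · simp [hs₁, execAll, Op.exec, hv]
  · simp [hs₁, execAll, Op.exec, hv, hlen]
  · refine ⟨hq₁, by rw [hr₁ _ (by simp)]; rfl, fun f => by rw [ha₁ _ (by simp)]; simp, rfl,
      fun x hx => hr₁ x fun h => hx (by simp at h ⊢; tauto), fun _ _ => rfl⟩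
  · rintro done f rest t s' hsplit ⟨hq, hfree, hcnt, ht, hr, ha⟩
    have hf0 : done.count f = 0 := by
      rw [hsplit] at hnodup
      rw [List.count_eq_zero]
      intro hmem
      exact (List.nodup_append.mp hnodup).2.2 f hmem f (by simp) rfl
    have hvf : v ∈ H.edge f := (A.mem_edgesAt v f).mp (by rw [hsplit]; simp)
    have hlt : s.a .cnt f + 1 ≤ n := by
      rw [h.counted f]
      refine (Finset.card_lt_card (t := Finset.univ) ?_).trans_eq (by simp)
      refine Finset.ssubset_univ_iff.mpr fun heq => ?_
      have := heq ▸ Finset.mem_univ v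
      simp [hcov] at this
    have hlen' := congrArg List.length hsplit
    simp only [List.length_append, List.length_cons] at hlen'
    refine (ensures_bump (f := f) hDw (by simpa using hq) (by simp) (by omega) ?_ ?_).mono ?_
    · simp only [hcnt, hf0]
      omega
    · simp [hfree]
      omega
    · rintro t' s'' ⟨rfl, hq', hfree', hcnt', hr', ha'⟩
      refine ⟨⟨hq', ?_, fun g => ?_, ?_, fun x hx => ?_, fun j hj => ?_⟩, ?_, ?_, ?_⟩
      · rw [hfree']
        simp [hfree, Nat.add_assoc]
      · rw [hcnt', List.count_append, ← Nat.add_assoc, ← hcnt g]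
        by_cases hg : g = f
        · subst hg
          simp
        · rw [List.count_eq_zero.mpr (by simpa using hg)]
          simp [Fin.val_inj, hg]
      · simp [ht]
        omega
      · rw [hr' x fun h => hx (by simp at h ⊢; tauto)]
        simp only [List.mem_cons, not_or] at hx
        simp [hx]
        exact hr x (by simp [hx])
      · rw [ha' j hj, ← ha j hj]
      · rw [hr' _ (by simp)]
        simp
      · rw [hr' _ (by simp)]
        simp
      · rw [ha' _ (by simp)]
  · rintro t s' ⟨t', rfl, hq, hfree, hcnt, rfl, hr, ha⟩
    have hcov' : s'.a .cov = Function.update (s.a .cov) v (s.r .time) := by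
      rw [ha _ (by simp), hcov₁]
    refine ⟨⟨h.loaded.congr (hr _ (by simp)) ?_ ?_, hq, fun f => ?_, ?_⟩, ?_, hcov', hr,
      fun j hj => ?_⟩
    · rw [ha _ (by simp), ha₁ _ (by simp)]
    · rw [ha _ (by simp), ha₁ _ (by simp)]
    · rw [hcnt, h.counted, hcov']
      by_cases hvf : v ∈ H.edge f
      · rw [List.count_eq_one_of_mem hnodup ((A.mem_edgesAt v f).mpr hvf),
          ← Finset.card_insert_of_notMem (a := v) (by simp [hcov])]
        congr 1
        ext u
        by_cases hu : u = v
        · subst hu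
          simp [htime, hvf]
        · simp [hu, Fin.val_inj]
      · rw [List.count_eq_zero_of_not_mem fun h => hvf ((A.mem_edgesAt v f).mp h),
          Nat.add_zero]
        congr 1
        refine Finset.filter_congr fun u hu => ?_
        have : u ≠ v := fun h => hvf (h ▸ hu)
        simp [this, Fin.val_inj]
    · have : (Finset.univ.filter fun u : Fin n => s.a .cov (u : ℕ) = 0) =
          insert v (Finset.univ.filter fun u : Fin n => s'.a .cov (u : ℕ) = 0) := by
        ext u
        by_cases hu : u = v
        · subst hu
          simp [hcov]
        · simp [hu, Fin.val_inj, hcov']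
      rw [this, Finset.sum_insert (by simp [hcov', htime])] at hbudget
      omega
    · simp
      omega
    · simp only [List.mem_cons, not_or] at hj
      rw [ha j (by simp [hj]), ha₁ j hj.1]

end Marking

/-- Mark the vertex `vertex` if it is new. Otherwise record the time when it was marked. -/
def visitVertex : Cmd :=
  (Cmd.block [.ld .cover .cov .vertex]).seq <|
    .ite (.pos .cover) (.ite (.lt .last .cover) (.block [.subc .last .cover 0]) .skip) markVertex

/-- Report a pair if `best` equals `x`. -/
def reportIfEq (x : Var) : Cmd :=
  .ite (.eq .best x) (.block [.const .out 1]) .skip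

/-- Select the hyperedge `edge`. -/
def selectEdge : Cmd :=
  (Cmd.block [.const .flag 1, .st .sel .edge .flag, .addc .time .time 1, .add .endAddr .numV .edge,
    .ld .endAddr .off .endAddr, .ld .card .inp .endAddr, .subc .addr .endAddr 0, .add .endAddr .endAddr .card,
    .const .last 0]).seq <|
  (Cmd.forEach .addr .endAddr .vertex visitVertex).seq <|
  (Cmd.block [.addc .card .card 1, .st .size .time .card]).seq <|
  (reportIfEq .card).seq <|
  (Cmd.block [.ld .flag .size .last]).seq <|
  (reportIfEq .flag).seq <|
  .block [.subc .best .card 0]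

/-- Take a hyperedge from the bucket `best` and select it, if this was not done before. Go to the
next smaller bucket if there is none. -/
def searchStep : Cmd :=
  (Cmd.block [.ld .top .head .best]).seq <|
    .ite (.pos .top)
      ((Cmd.block [.ld .edge .ent .top, .ld .top .nxt .top, .st .head .best .top,
        .ld .flag .sel .edge]).seq <| .ite (.pos .flag) .skip selectEdge)
      (.block [.subc .best .best 1])

section Search

variable {n m : ℕ} {H : IndexedHypergraph (Fin n) (Fin m)} {A : H.AdjacencyLists}
  {D w pops : ℕ} {Q : Fin m → Prop}

theorem ensures_reportIfEq {K : ℕ} (hw : 1 ≤ w) (x : Var) (s : State) :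
    (reportIfEq x).Ensures K D w s fun t s' => t ≤ 4 ∧
      s' = ⟨Function.update s.r .out (if s.r .best = s.r x then 1 else s.r .out), s.a⟩ := by
  refine .ite (fun h => .block ?_ ?_) (fun h => .skip ?_)
  · simpa [SafeAll, Op.Safe] using hw
  · have h' : s.r .best = s.r x := h
    simp [execAll, Op.exec, h']
  · have h' : ¬ s.r .best = s.r x := h
    simp [h']

theorem ensures_visitVertices (hD : n + m + 2 * H.totalSize + 2 ≤ D) (hDw : 9 * D ≤ w)
    {s : State} (h : Marking A D Q pops s) (htime : s.r .time ≠ 0) {xs : List (Fin n)} {o : ℕ}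
    (hxs : ElemsAt D (s.a .inp) o xs) (hnodup : xs.Nodup) (hptr : s.r .addr = o)
    (hlim : s.r .endAddr = o + xs.length) (hlast : s.r .last = 0) :
    (Cmd.forEach .addr .endAddr .vertex visitVertex).Ensures 9 D w s fun t s' =>
      Marking A D Q pops s' ∧ s.r .free ≤ s'.r .free ∧
      t + 25 * s.r .free ≤ 25 * s'.r .free + 30 * xs.length + 3 ∧
      (∀ u : Fin n, s'.a .cov u =
        if s.a .cov u ≠ 0 then s.a .cov u else if u ∈ xs then s.r .time else 0) ∧
      s'.r .last = xs.toFinset.sup (fun u : Fin n => s.a .cov u) ∧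
      (∀ x ∉ [.free, .top, .flag, .bucket, .nbr, .addr', .endAddr', .addr, .vertex, .cover, .last],
        s'.r x = s.r x) ∧
      ∀ j ∉ [.cov, .cnt, .head, .ent, .nxt], s'.a j = s.a j := by
  refine (Cmd.Ensures.forEach (by omega) (by omega) (xs := xs) (o := o)
    (fun done t s' => Marking A D Q pops s' ∧ s.r .free ≤ s'.r .free ∧
      t + 25 * s.r .free ≤ 25 * s'.r .free + 30 * done.length ∧
      (∀ u : Fin n, s'.a .cov u =
        if s.a .cov u ≠ 0 then s.a .cov u else if u ∈ done then s.r .time else 0) ∧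
      s'.r .last = done.toFinset.sup (fun u : Fin n => s.a .cov u) ∧
      (∀ x ∉ [.free, .top, .flag, .bucket, .nbr, .addr', .endAddr', .addr, .vertex, .cover, .last],
        s'.r x = s.r x) ∧
      ∀ j ∉ [.cov, .cnt, .head, .ent, .nxt], s'.a j = s.a j) hxs hptr hlim ?_ ?_).mono ?_
  · refine ⟨h, le_rfl, by simp, fun u => ?_, by simp [hlast], fun _ _ => rfl, fun _ _ => rfl⟩
    by_cases h0 : s.a .cov u = 0 <;> simp [h0]
  · rintro done v rest t s' hsplit ⟨hM, hfree, ht, hcov, hl, hr, ha⟩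
    have hv : v ∉ done := by
      rw [hsplit] at hnodup
      exact fun hmem => (List.nodup_append.mp hnodup).2.2 v hmem v (by simp) rfl
    have hcv : s'.a .cov v = s.a .cov v := by
      rw [hcov, if_neg hv]
      split_ifs with h0 <;> simp_all
    have hvn := v.2
    have hfree' := hM.free_le
    refine .seq (.block (by simp [SafeAll, Op.Safe, Arr.ctorIdx]; omega) ?_)
    simp only [execAll, Op.exec, Function.update_self, hcv]
    have hsup : (done ++ [v]).toFinset.sup (fun u : Fin n => s.a .cov u) =
        max (s'.r .last) (s.a .cov v) := by
      rw [List.toFinset_append, Finset.sup_union, ← hl]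
      simp
    have hcov₁ : s.a .cov v ≠ 0 → ∀ u : Fin n, s'.a .cov u =
        if s.a .cov u ≠ 0 then s.a .cov u else if u ∈ done ++ [v] then s.r .time else 0 := by
      intro h0 u
      rw [hcov]
      by_cases huv : u = v
      · simp [huv, h0]
      · simp [huv]
    refine .ite (fun hpos => .ite (fun hlt => .block ?_ ?_) (fun hlt => .skip ?_)) (fun hpos => ?_)
    · simp [SafeAll, Op.Safe]
    · simp only [Cond.Holds, Function.update_self, ne_eq, reduceCtorEq, not_false_eq_true,
        Function.update_of_ne] at hpos hlt
      refine ⟨⟨?_, by simpa [execAll, Op.exec] using hfree, ?_, ?_, ?_, fun x hx => ?_, ha⟩,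
        ?_, ?_, rfl⟩
      · exact hM.congr (by simp [execAll, Op.exec]) (by simp [execAll, Op.exec])
      · simp [execAll, Op.exec]
        omega
      · simpa [execAll, Op.exec] using hcov₁ hpos.ne'
      · rw [hsup]
        simp [execAll, Op.exec]
        omega
      · rw [← hr x hx]
        simp only [List.mem_cons, not_or] at hx
        simp [execAll, Op.exec, hx]
      · simp [execAll, Op.exec]
      · simp [execAll, Op.exec]
    · simp only [Cond.Holds, Function.update_self, ne_eq, reduceCtorEq, not_false_eq_true,
        Function.update_of_ne] at hpos hlt
      refine ⟨⟨?_, by simpa using hfree, ?_, ?_, ?_, fun x hx => ?_, ha⟩, ?_, ?_, rfl⟩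
      · exact hM.congr (by simp) (by simp)
      · simp
        omega
      · simpa using hcov₁ hpos.ne'
      · rw [hsup]
        simp
        omega
      · rw [← hr x hx]
        simp only [List.mem_cons, not_or] at hx
        simp [hx]
      · simp
      · simp
    · simp only [Cond.Holds, Function.update_self, Nat.pos_iff_ne_zero, not_not] at hpos
      refine (ensures_markVertex (A := A) (v := v) (Q := Q) (pops := pops) hD hDw ?_ ?_ ?_ ?_).mono ?_
      · exact hM.congr (by simp) (by simp)
      · simp
      · simpa [hcv] using hpos
      · simpa [hr] using htime
      · rintro t' s'' ⟨hM', ht', hcov', hr', ha'⟩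
        simp only [ne_eq, reduceCtorEq, not_false_eq_true, Function.update_of_ne] at ht' hcov'
        refine ⟨⟨hM', by omega, ?_, fun u => ?_, ?_, fun x hx => ?_, fun j hj => ?_⟩, ?_, ?_, ?_⟩
        · simp
          omega
        · rw [hcov', hr _ (by simp)]
          by_cases huv : u = v
          · simp [huv, hpos]
          · rw [Function.update_of_ne (by simpa [Fin.val_inj] using huv), hcov]
            simp [huv]
        · rw [hsup, hpos, hr' _ (by simp)]
          simp
        · rw [hr' x fun h => hx (by simp at h ⊢; tauto), ← hr x hx]
          simp only [List.mem_cons, not_or] at hx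
          simp [hx]
        · rw [ha' j hj, ← ha j hj]
        · rw [hr' _ (by simp)]
          simp
        · rw [hr' _ (by simp)]
          simp
        · rw [ha' _ (by simp)]
  · rintro t s' ⟨t', rfl, h1, h2, h3, h4⟩
    exact ⟨h1, h2, by omega, h4⟩

end Search

section Search

variable {n m : ℕ} {H : IndexedHypergraph (Fin n) (Fin m)} {A : H.AdjacencyLists}
  {D w pops : ℕ} {Q : Fin m → Prop} {T : SimpleGraph (Fin m)} {l : List (Fin m)} {s : State}

open Classical in
/-- The state of the search after the hyperedges of the list `l` were selected. -/
structure Searching (A : H.AdjacencyLists) (D : ℕ) (T : SimpleGraph (Fin m)) (l : List (Fin m))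
    (Q : Fin m → Prop) (pops : ℕ) (s : State) : Prop where
  marking : Marking A D Q pops s
  componentsAttached : H.ComponentsAttached T l
  runningIntersection : H.RunningIntersection l
  sel : ∀ e : Fin m, s.a .sel e = if e ∈ l then 1 else 0
  cov : ∀ v : Fin n, s.a .cov v = H.coverTime l v
  size : ∀ t, s.a .size t = H.sizeSucc l t
  time : s.r .time = l.length
  out : s.r .out = if H.PairFound l then 1 else 0
  best : ∀ e ∉ l, s.a .cnt e + 1 ≤ s.r .best
  best_le : s.r .best ≤ n + 1

theorem Searching.congr {s' : State} (h : Searching A D T l Q pops s)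
    (hr : ∀ x ∈ [Var.numV, .free, .time, .out, .best], s'.r x = s.r x)
    (ha : ∀ j ∈ [Arr.inp, .off, .cnt, .cov, .head, .ent, .nxt, .sel, .size], s'.a j = s.a j) :
    Searching A D T l Q pops s' := by
  refine ⟨h.marking.congr (fun x hx => hr x (by simp at hx ⊢; tauto))
    (fun j hj => ha j (by simp at hj ⊢; tauto)), h.componentsAttached, h.runningIntersection,
    ?_, ?_, ?_, ?_, ?_, ?_, ?_⟩
  · rw [ha _ (by simp)]; exact h.sel
  · rw [ha _ (by simp)]; exact h.cov
  · rw [ha _ (by simp)]; exact h.size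
  · rw [hr _ (by simp)]; exact h.time
  · rw [hr _ (by simp)]; exact h.out
  · rw [hr _ (by simp), ha _ (by simp)]; exact h.best
  · rw [hr _ (by simp)]; exact h.best_le

theorem Marking.card_shared (h : Marking A D Q pops s)
    (hcov : ∀ v : Fin n, s.a .cov v = H.coverTime l v) (e : Fin m) :
    s.a .cnt e = (H.shared l e).card := by
  rw [h.counted]
  congr 1
  ext v
  simp only [Finset.mem_filter, hcov, coverTime_ne_zero_iff, mem_shared]

theorem ensures_selectEdge (hD : n + m + 2 * H.totalSize + 2 ≤ D) (hDw : 9 * D ≤ w)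
    (hT : H.IsJoinTree T) {e : Fin m} (h : Searching A D T l (· ∉ e :: l) pops s)
    (he : s.r .edge = e) (hel : e ∉ l) (hbest : s.r .best = s.a .cnt e + 1) :
    selectEdge.Ensures 9 D w s fun t s' => Searching A D T (e :: l) (· ∉ e :: l) pops s' ∧
      s.r .free ≤ s'.r .free ∧ s'.r .best = (H.edge e).card + 1 ∧
      t + 25 * s.r .free ≤ 25 * s'.r .free + 30 * (H.edge e).card + 60 := by
  obtain ⟨⟨hmem, helems⟩, hlen⟩ := h.marking.loaded.verticesOf e
  have hnodup := A.verticesOf_nodup e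
  have hset : (A.verticesOf e).toFinset = H.edge e := by
    ext v
    simp [A.mem_verticesOf]
  have hcard : (A.verticesOf e).length = (H.edge e).card := by
    rw [← hset, List.toFinset_card_of_nodup hnodup]
  have hcn : (H.edge e).card ≤ n := (Finset.card_le_univ _).trans_eq (by simp)
  have hlm : l.length + 1 ≤ m := by
    simpa using (List.nodup_cons.mpr ⟨hel, h.runningIntersection.nodup⟩).length_le_card
  have hcnt := h.marking.card_shared h.cov
  have hmax : H.IsMaxShared l e := by
    refine ⟨hel, fun x hx => ?_⟩
    have := h.best x hx
    rw [hbest, hcnt, hcnt] at this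
    omega
  have hen := e.2
  have hnumV := h.marking.loaded.numV
  refine .seq (.block ?_ ?_)
  · simp [SafeAll, Op.Safe, Op.exec, Arr.ctorIdx, he, h.time, hnumV, hlen]
    omega
  set s₁ := execAll s [.const .flag 1, .st .sel .edge .flag, .addc .time .time 1,
    .add .endAddr .numV .edge, .ld .endAddr .off .endAddr, .ld .card .inp .endAddr, .subc .addr .endAddr 0,
    .add .endAddr .endAddr .card, .const .last 0] with hs₁
  have ha₁ : ∀ j ≠ Arr.sel, s₁.a j = s.a j := fun j hj => by
    simp [hs₁, execAll, Op.exec, hj]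
  have hr₁ : ∀ x ∉ [Var.flag, .time, .endAddr, .card, .addr, .last], s₁.r x = s.r x := fun x hx => by
    simp only [List.mem_cons, not_or] at hx
    simp [hs₁, execAll, Op.exec, hx]
  have hsel₁ : s₁.a .sel = Function.update (s.a .sel) e 1 := by
    simp [hs₁, execAll, Op.exec, he]
  have htime₁ : s₁.r .time = l.length + 1 := by
    simp [hs₁, execAll, Op.exec, h.time]
  have hcard₁ : s₁.r .card = (H.edge e).card := by
    simp [hs₁, execAll, Op.exec, he, hnumV, hlen, hcard]
  refine .seq ((ensures_visitVertices (A := A) (D := D) (Q := (· ∉ e :: l)) (pops := pops)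
    (xs := A.verticesOf e) (o := s.a .off (n + e)) hD hDw ?_ ?_ ?_ hnodup ?_ ?_ ?_).mono ?_)
  · refine h.marking.congr (fun x hx => hr₁ x ?_) (fun j hj => ha₁ j ?_)
    · simp at hx ⊢
      rcases hx with rfl | rfl <;> simp
    · rintro rfl
      simp at hj
  · simp [htime₁]
  · rw [ha₁ _ (by simp)]
    exact ⟨hmem, helems⟩
  · simp [hs₁, execAll, Op.exec, he, hnumV]
  · simp [hs₁, execAll, Op.exec, he, hnumV, hlen]
  · simp [hs₁, execAll, Op.exec]
  rintro t s₂ ⟨hM, hfree, ht, hcov, hlast, hr, ha⟩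
  have hcov₂ : ∀ u : Fin n, s₂.a .cov u = H.coverTime (e :: l) u := by
    intro u
    rw [hcov, ha₁ _ (by simp), h.cov, htime₁]
    simp only [coverTime, A.mem_verticesOf]
    split_ifs <;> rfl
  have hlast₂ : s₂.r .last = H.lastCoverTime l e := by
    rw [hlast, hset, lastCoverTime, ha₁ _ (by simp)]
    simp only [h.cov]
  have hlast_le : H.lastCoverTime l e ≤ l.length :=
    Finset.sup_le fun v _ => H.coverTime_le l v
  have htime₂ : s₂.r .time = l.length + 1 := by rw [hr _ (by simp), htime₁]
  have hcard₂ : s₂.r .card = (H.edge e).card := by rw [hr _ (by simp), hcard₁]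
  have hbest₂ : s₂.r .best = (H.shared l e).card + 1 := by
    rw [hr _ (by simp), hr₁ _ (by simp), hbest, hcnt]
  have hout₂ : s₂.r .out = s.r .out := by rw [hr _ (by simp), hr₁ _ (by simp)]
  have hsize₂ : s₂.a .size = s.a .size := by rw [ha _ (by simp), ha₁ _ (by simp)]
  have hsel₂ : s₂.a .sel = Function.update (s.a .sel) e 1 := by rw [ha _ (by simp), hsel₁]
  have hfree₁ : s₁.r .free = s.r .free := hr₁ _ (by simp)
  refine .seq (.block ?_ ?_)
  · simp [SafeAll, Op.Safe, Op.exec, Arr.ctorIdx, htime₂, hcard₂]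
    omega
  refine .seq ((ensures_reportIfEq (by omega) _ _).mono ?_)
  rintro t₃ _ ⟨ht₃, rfl⟩
  refine .seq (.block ?_ ?_)
  · simp [SafeAll, Op.Safe, execAll, Op.exec, Arr.ctorIdx, hlast₂]
    omega
  refine .seq ((ensures_reportIfEq (by omega) _ _).mono ?_)
  rintro t₄ _ ⟨ht₄, rfl⟩
  refine .block (by simp [SafeAll, Op.Safe]) ?_
  have hM' := hM.card_shared hcov₂
  have hatt := (h.componentsAttached.exists_root hmax).1
  refine ⟨⟨hM.congr ?_ ?_, h.componentsAttached.cons hT hmax, ⟨hel, hatt, h.runningIntersection⟩,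
    fun f => ?_, ?_, fun t' => ?_, ?_, ?_, fun f hf => ?_, ?_⟩, ?_, ?_, ?_⟩
  · simp [execAll, Op.exec]
  · simp [execAll, Op.exec]
  · simp only [execAll, Op.exec, ne_eq, reduceCtorEq, not_false_eq_true, Function.update_of_ne,
      hsel₂]
    by_cases hf : f = e
    · simp [hf]
    · simp [hf, Fin.val_inj, h.sel]
  · simpa [execAll, Op.exec] using hcov₂
  · simp only [execAll, Op.exec, ne_eq, reduceCtorEq, not_false_eq_true, Function.update_of_ne,
      Function.update_self, hsize₂, htime₂, hcard₂, sizeSucc, Function.update_apply, h.size]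
  · simp [execAll, Op.exec, htime₂]
  · simp only [execAll, Op.exec, ne_eq, reduceCtorEq, not_false_eq_true, Function.update_of_ne,
      Function.update_self, hsize₂, htime₂, hcard₂, hlast₂, hbest₂, hout₂, h.size, h.out,
      Function.update_of_ne (show H.lastCoverTime l e ≠ l.length + 1 by omega)]
    by_cases h1 : H.PairFound l <;>
      by_cases h2 : (H.shared l e).card = (H.edge e).card <;>
      by_cases h3 : (H.shared l e).card + 1 = H.sizeSucc l (H.lastCoverTime l e) <;>
      simp [PairFound, PairFoundAt, h1, h2, h3]
  · have hfl : f ∉ l := fun h => hf (List.mem_cons_of_mem _ h)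
    simpa [execAll, Op.exec, hcard₂, hM'] using hmax.card_shared_cons_le hfl
  · simp [execAll, Op.exec, hcard₂]
    omega
  · simp [execAll, Op.exec]
    omega
  · simp [execAll, Op.exec, hcard₂]
  · simp [execAll, Op.exec]
    omega

end Search

section Search

variable {n m : ℕ} {H : IndexedHypergraph (Fin n) (Fin m)} {A : H.AdjacencyLists}
  {D w pops : ℕ} {Q : Fin m → Prop} {T : SimpleGraph (Fin m)} {l : List (Fin m)} {s : State}

/-- The hyperedges outside the list and their vertices still have to be processed. -/
def remaining (H : IndexedHypergraph (Fin n) (Fin m)) (l : List (Fin m)) : ℕ :=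
  ∑ e ∈ Finset.univ.filter (· ∉ l), ((H.edge e).card + 1)

theorem remaining_cons {e : Fin m} (he : e ∉ l) :
    remaining H (e :: l) + ((H.edge e).card + 1) = remaining H l := by
  have : Finset.univ.filter (· ∉ l) = insert e (Finset.univ.filter (· ∉ e :: l)) := by
    ext x
    by_cases hx : x = e <;> simp [hx, he]
  rw [remaining, remaining, this, Finset.sum_insert (by simp), Nat.add_comm]

theorem Searching.imp {Q' : Fin m → Prop} (h : Searching A D T l Q pops s)
    (hQ : ∀ e, Q' e → Q e) : Searching A D T l Q' pops s :=
  { h with marking := { h.marking with queue := h.marking.queue.imp hQ } }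

/-- The invariant of the search. The number `N` bounds the number of steps. -/
def SearchInvariant (A : H.AdjacencyLists) (D : ℕ) (T : SimpleGraph (Fin m)) (N : ℕ)
    (s : State) : Prop :=
  ∃ l pops, Searching A D T l (· ∉ l) pops s ∧
    N = 20 * (s.r .free - pops) + 10 * s.r .best + 120 * remaining H l +
      45 * (m + H.totalSize - s.r .free)

theorem ensures_searchStep (hD : n + m + 2 * H.totalSize + 2 ≤ D) (hDw : 9 * D ≤ w)
    (hT : H.IsJoinTree T) {N : ℕ} (h : SearchInvariant A D T N s) (hpos : 0 < s.r .best) :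
    searchStep.Ensures 9 D w s fun t s' =>
      ∃ N', SearchInvariant A D T N' s' ∧ t + 3 + N' ≤ N := by
  obtain ⟨l, pops, h, rfl⟩ := h
  have hbest_le := h.best_le
  have hpops := h.marking.queue.pops_le
  have hfree := h.marking.free_le
  have hbD : s.r .best < D := by omega
  refine .seq (.block ?_ ?_)
  · simp [SafeAll, Op.Safe, Arr.ctorIdx]
    omega
  refine .ite (fun htop => ?_) (fun htop => .block ?_ ?_)
  · have htop : 0 < s.a .head (s.r .best) := by
      simpa [Cond.Holds, execAll, Op.exec] using htop
    obtain ⟨e, hle, hent, hye, hpop⟩ := h.marking.queue.pop hbD htop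
    have hen := e.2
    refine .seq (.block ?_ ?_)
    · simp [SafeAll, Op.Safe, execAll, Op.exec, Arr.ctorIdx, hent]
      omega
    set s₁ := execAll (execAll s [.ld .top .head .best]) [.ld .edge .ent .top, .ld .top .nxt .top,
      .st .head .best .top, .ld .flag .sel .edge] with hs₁
    have ha₁ : ∀ j ≠ Arr.head, s₁.a j = s.a j := fun j hj => by
      simp [hs₁, execAll, Op.exec, hj]
    have hr₁ : ∀ x ∉ [Var.top, .edge, .flag], s₁.r x = s.r x := fun x hx => by
      simp only [List.mem_cons, not_or] at hx
      simp [hs₁, execAll, Op.exec, hx]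
    have hq := hpop s₁.a (ha₁ _ (by simp)) (ha₁ _ (by simp)) (ha₁ _ (by simp))
      (by simp [hs₁, execAll, Op.exec])
    have hfree₁ : s₁.r .free = s.r .free := hr₁ _ (by simp)
    have hbest₁ : s₁.r .best = s.r .best := hr₁ _ (by simp)
    have hpops₁ := hq.pops_le
    have hflag : s₁.r .flag = s.a .sel e := by simp [hs₁, execAll, Op.exec, hent]
    have hedge : s₁.r .edge = e := by simp [hs₁, execAll, Op.exec, hent]
    have h₁ : Searching A D T l (fun e' => e' ∉ l ∧ e' ≠ e) (pops + 1) s₁ := by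
      refine ⟨⟨h.marking.loaded.congr (hr₁ _ (by simp)) (ha₁ _ (by simp)) (ha₁ _ (by simp)),
        hfree₁ ▸ hq, ?_, ?_⟩, h.componentsAttached, h.runningIntersection, ?_, ?_, ?_, ?_, ?_, ?_,
        ?_⟩
      · rw [ha₁ _ (by simp), ha₁ _ (by simp)]
        exact h.marking.counted
      · rw [hfree₁, ha₁ _ (by simp)]
        exact h.marking.budget
      · rw [ha₁ _ (by simp)]
        exact h.sel
      · rw [ha₁ _ (by simp)]
        exact h.cov
      · rw [ha₁ _ (by simp)]
        exact h.size
      · rw [hr₁ _ (by simp)]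
        exact h.time
      · rw [hr₁ _ (by simp)]
        exact h.out
      · rw [hbest₁, ha₁ _ (by simp)]
        exact h.best
      · rw [hbest₁]
        exact h.best_le
    refine .ite (fun hsel => .skip ?_) (fun hsel => ?_)
    · have hel : e ∈ l := by
        have : 0 < s₁.r .flag := hsel
        rw [hflag, h.sel] at this
        by_contra hel
        simp [hel] at this
      refine ⟨_, ⟨l, pops + 1, h₁.imp fun e' he' => ⟨he', fun h => he' (h ▸ hel)⟩, rfl⟩, ?_⟩
      rw [hfree₁, hbest₁]
      simp only [List.length_cons, List.length_nil]
      omega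
    · have hel : e ∉ l := by
        have : ¬ 0 < s₁.r .flag := hsel
        rw [hflag, h.sel] at this
        intro hel
        simp [hel] at this
      have h₂ := h.best e hel
      have hQ : Searching A D T l (· ∉ e :: l) (pops + 1) s₁ :=
        h₁.imp fun e' he' => by simpa [and_comm] using he'
      refine (ensures_selectEdge hD hDw hT hQ hedge hel ?_).mono ?_
      · rw [hbest₁, ha₁ _ (by simp)]
        omega
      · rintro t s' ⟨h', hfree', hbest', ht⟩
        refine ⟨_, ⟨e :: l, pops + 1, h', rfl⟩, ?_⟩
        have hrem := remaining_cons (H := H) hel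
        have hfree₂ := h'.marking.free_le
        rw [hbest']
        simp only [List.length_cons, List.length_nil]
        omega
  · simp [SafeAll, Op.Safe]
    omega
  · have htop : s.a .head (s.r .best) = 0 := by
      simpa [Cond.Holds, execAll, Op.exec] using htop
    have hlt : ∀ e ∉ l, s.a .cnt e + 1 ≤ s.r .best - 1 := fun e he => by
      have h1 := h.best e he
      have h2 := h.marking.queue.cnt_ne htop he
      omega
    refine ⟨_, ⟨l, pops, ⟨h.marking.congr ?_ ?_, h.componentsAttached, h.runningIntersection,
      h.sel, h.cov, h.size, ?_, ?_, ?_, ?_⟩, rfl⟩, ?_⟩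
    · simp [execAll, Op.exec]
    · simp [execAll, Op.exec]
    · simpa [execAll, Op.exec] using h.time
    · simpa [execAll, Op.exec] using h.out
    · simpa [execAll, Op.exec] using hlt
    · simp [execAll, Op.exec]
      omega
    · simp [execAll, Op.exec]
      omega

open Classical in
theorem ensures_search (hD : n + m + 2 * H.totalSize + 2 ≤ D) (hDw : 9 * D ≤ w)
    (hT : H.IsJoinTree T) {N : ℕ} (h : SearchInvariant A D T N s) :
    (Cmd.loop (.pos .best) searchStep).Ensures 9 D w s fun t s' => t ≤ N + 3 ∧
      s'.r .out = if H.HasSpernerPair then 1 else 0 := by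
  refine (Cmd.Ensures.loop_of_invariant (b := .pos .best) (fun N s hs hpos => ensures_searchStep hD hDw hT hs hpos)
    h).mono ?_
  rintro t s' ⟨N', ⟨l, pops, h, -⟩, hpos, ht⟩
  refine ⟨by omega, ?_⟩
  have hmem : ∀ e, e ∈ l := by
    intro e
    by_contra hel
    have h1 := h.best e hel
    have h2 : ¬ 0 < s'.r .best := hpos
    omega
  have hiff : H.PairFound l ↔ H.HasSpernerPair := by
    rw [h.runningIntersection.pairFound_iff]
    simp [hmem, HasSpernerPair]
  rw [h.out]
  simp [hiff]

end Search

end RAM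

namespace IndexedHypergraph

variable {n m : ℕ} {H : IndexedHypergraph (Fin n) (Fin m)} (A : H.AdjacencyLists)

/-! ### The layout of the input -/

theorem AdjacencyLists.length_verticesOf (e : Fin m) :
    (A.verticesOf e).length = (H.edge e).card := by
  rw [← List.toFinset_card_of_nodup (A.verticesOf_nodup e)]
  congr 1
  ext v
  simp [A.mem_verticesOf]

theorem AdjacencyLists.length_edgesAt (v : Fin n) :
    (A.edgesAt v).length = (Finset.univ.filter fun e => v ∈ H.edge e).card := by
  rw [← List.toFinset_card_of_nodup (A.edgesAt_nodup v)]
  congr 1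
  ext e
  simp [A.mem_edgesAt]

theorem AdjacencyLists.sum_length_edgesAt :
    ∑ v, (A.edgesAt v).length = H.totalSize := by
  simp only [A.length_edgesAt, Finset.card_filter, totalSize]
  rw [Finset.sum_comm]
  simp

/-- The adjacency lists in the order of the input. -/
def AdjacencyLists.lists : List (List ℕ) :=
  (List.finRange n).map (fun v => (A.edgesAt v).map Fin.val) ++
    (List.finRange m).map (fun e => (A.verticesOf e).map Fin.val)

/-- The address of the list number `i`. -/
def AdjacencyLists.offset (i : ℕ) : ℕ :=
  2 + ((A.lists.take i).flatMap fun xs => xs.length :: xs).length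

theorem AdjacencyLists.encode_eq :
    A.encode = [n, m] ++ A.lists.flatMap fun xs => xs.length :: xs := by
  simp [encode, lists, List.flatMap_map]

theorem AdjacencyLists.length_lists : A.lists.length = n + m := by
  simp [lists]

theorem AdjacencyLists.offset_zero : A.offset 0 = 2 := rfl

theorem AdjacencyLists.offset_succ {i : ℕ} (hi : i < A.lists.length) :
    A.offset (i + 1) = A.offset i + A.lists[i].length + 1 := by
  simp only [offset, List.take_add_one, List.getElem?_eq_getElem hi, Option.toList_some,
    List.flatMap_append, List.length_append, List.flatMap_cons, List.flatMap_nil,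
    List.length_cons, List.length_nil]
  omega

theorem AdjacencyLists.offset_last : A.offset (n + m) = A.encode.length := by
  rw [← A.length_lists, offset, List.take_length, A.encode_eq, List.length_append]
  rfl

theorem AdjacencyLists.encode_split {i : ℕ} (hi : i < A.lists.length) :
    ∃ pre post, A.encode = pre ++ (A.lists[i].length :: A.lists[i] ++ post) ∧
      pre.length = A.offset i := by
  refine ⟨[n, m] ++ (A.lists.take i).flatMap (fun xs => xs.length :: xs),
    (A.lists.drop (i + 1)).flatMap (fun xs => xs.length :: xs), ?_, ?_⟩
  · rw [A.encode_eq, List.append_assoc]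
    congr 1
    conv_lhs => rw [← List.take_append_drop i A.lists, List.drop_eq_getElem_cons hi,
      List.flatMap_append, List.flatMap_cons]
  · simp only [offset, List.length_append]
    rfl

theorem AdjacencyLists.getD_offset {i : ℕ} (hi : i < A.lists.length) :
    A.encode.getD (A.offset i) 0 = A.lists[i].length := by
  obtain ⟨pre, post, h, hpre⟩ := A.encode_split hi
  rw [h, ← hpre]
  simp

theorem AdjacencyLists.getD_offset_add {i j : ℕ} (hi : i < A.lists.length)
    (hj : j < A.lists[i].length) : A.encode.getD (A.offset i + 1 + j) 0 = A.lists[i][j] := by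
  obtain ⟨pre, post, h, hpre⟩ := A.encode_split hi
  rw [h, ← hpre, Nat.add_assoc, List.getD_append_right _ _ _ _ (by omega),
    Nat.add_sub_cancel_left, List.cons_append, Nat.add_comm 1, List.getD_cons_succ,
    List.getD_append _ _ _ _ hj, List.getD_eq_getElem _ _ hj]

theorem AdjacencyLists.offset_add_lt {i : ℕ} (hi : i < A.lists.length) :
    A.offset i + A.lists[i].length < A.encode.length := by
  obtain ⟨pre, post, h, hpre⟩ := A.encode_split hi
  rw [h, ← hpre]
  simp

theorem AdjacencyLists.length_encode : A.encode.length = n + m + 2 * H.totalSize + 2 := by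
  have h : ∀ {k : ℕ} (f : Fin k → ℕ), ((List.finRange k).map f).sum = ∑ i, f i := fun f => by
    rw [← List.ofFn_eq_map, List.sum_ofFn]
  simp only [encode, List.length_append, List.length_flatMap, List.length_cons, List.length_map,
    List.length_nil, h, Finset.sum_add_distrib, A.sum_length_edgesAt, A.length_verticesOf]
  simp [totalSize]
  ring

theorem AdjacencyLists.encode_le {x : ℕ} (hx : x ∈ A.encode) : x ≤ n + m := by
  have h1 : ∀ v, (A.edgesAt v).length ≤ m := fun v => by
    simpa using (A.edgesAt_nodup v).length_le_card
  have h2 : ∀ e, (A.verticesOf e).length ≤ n := fun e => by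
    simpa using (A.verticesOf_nodup e).length_le_card
  simp only [encode, List.mem_append, List.mem_cons, List.not_mem_nil, or_false,
    List.mem_flatMap, List.mem_map] at hx
  rcases hx with ((rfl | rfl) | ⟨v, -, rfl | ⟨e, -, rfl⟩⟩) | ⟨e, -, rfl | ⟨v, -, rfl⟩⟩
  · omega
  · omega
  · have := h1 v; omega
  · have := e.2; omega
  · have := h2 e; omega
  · have := v.2; omega

theorem AdjacencyLists.lists_getElem_vertex (v : Fin n) :
    A.lists[(v : ℕ)]'(by rw [A.length_lists]; omega) = (A.edgesAt v).map Fin.val := by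
  simp [lists]

theorem AdjacencyLists.lists_getElem_edge (e : Fin m) :
    A.lists[n + (e : ℕ)]'(by rw [A.length_lists]; omega) = (A.verticesOf e).map Fin.val := by
  simp [lists]

end IndexedHypergraph

namespace RAM

open IndexedHypergraph

/-! ### The program -/

/-- Read the numbers of vertices and hyperedges, and go to the first adjacency list. -/
def readSizes : List Op :=
  [.const .idx 0, .ld .numV .inp .idx, .const .addr 1, .ld .numE .inp .addr,
    .add .blocks .numV .numE, .const .addr 2]

/-- Go to the next adjacency list. -/
def nextList : List Op :=
  [.ld .len .inp .addr, .add .addr .addr .len, .addc .addr .addr 1, .addc .idx .idx 1]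

/-- Compute the length of the input. -/
def measure : Cmd :=
  (Cmd.block readSizes).seq (.loop (.lt .idx .blocks) (.block nextList))

/-- Compute the addresses of the adjacency lists. -/
def tabulate : Cmd :=
  (Cmd.block readSizes).seq (.loop (.lt .idx .blocks) (.block (.st .off .idx .addr :: nextList)))

/-- Put all hyperedges into the bucket of the counter `0`. -/
def fillBucket : Cmd :=
  (Cmd.block [.const .idx 0, .const .free 0, .const .bucket 1, .const .out 0, .const .time 0,
    .const .best 1]).seq <|
  .loop (.lt .idx .numE) (.block (.subc .nbr .idx 0 :: (pushOps ++ [.addc .idx .idx 1])))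

def search : Cmd :=
  tabulate.seq (fillBucket.seq (.loop (.pos .best) searchStep))

section Correctness

variable {n m : ℕ} {H : IndexedHypergraph (Fin n) (Fin m)} {A : H.AdjacencyLists}
  {K D w : ℕ} {s : State}

theorem ensures_measure (hw : A.encode.length ≤ w)
    (hinp : s.a .inp = fun i => A.encode.getD i 0) :
    measure.Ensures 1 A.encode.length w s fun t s' => t ≤ 11 * (n + m) + 15 ∧
      s'.r .addr = A.encode.length ∧ s'.a = s.a := by
  have hlen := A.length_encode
  have h0 : A.encode.getD 0 0 = n := rfl
  have h1 : A.encode.getD 1 0 = m := rfl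
  refine .seq (.block ?_ ?_)
  · simp only [readSizes, SafeAll, Op.Safe, Op.exec, hinp, Arr.ctorIdx, Function.update_self, ne_eq,
      reduceCtorEq, not_false_eq_true, Function.update_of_ne, h0, h1, Nat.one_pos,
      true_and, and_true]
    omega
  refine (Cmd.Ensures.loop_of_invariant (b := .lt .idx .blocks) (N := 11 * (n + m))
    (I := fun N s' => s'.r .idx ≤ n + m ∧ N = 11 * (n + m - s'.r .idx) ∧
      s'.r .blocks = n + m ∧ s'.r .addr = A.offset (s'.r .idx) ∧ s'.a = s.a) ?_ ?_).mono ?_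
  · rintro N s' ⟨hi, rfl, hb, ha, harr⟩ hlt
    have hlt' : s'.r .idx < n + m := hb ▸ hlt
    have hil : s'.r .idx < A.lists.length := A.length_lists ▸ hlt'
    have hget := A.getD_offset hil
    have hoff := A.offset_add_lt hil
    have hsucc := A.offset_succ hil
    refine .block ?_ ⟨_, ⟨?_, rfl, ?_, ?_, ?_⟩, ?_⟩
    · simp only [nextList, SafeAll, Op.Safe, Op.exec, harr, hinp, ha, hget, Arr.ctorIdx,
        Function.update_self, ne_eq, reduceCtorEq, not_false_eq_true, Function.update_of_ne,
        Nat.one_pos, true_and, and_true]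
      omega
    · simp [nextList, execAll, Op.exec]
      omega
    · simpa [nextList, execAll, Op.exec] using hb
    · simp only [nextList, execAll, Op.exec, harr, hinp, ha, hget, hsucc,
        Function.update_self, ne_eq, reduceCtorEq, not_false_eq_true, Function.update_of_ne]
    · simpa [nextList, execAll, Op.exec] using harr
    · simp [nextList, execAll, Op.exec]
      omega
  · simp only [readSizes, execAll, Op.exec, hinp, Function.update_self, ne_eq,
      reduceCtorEq, not_false_eq_true, Function.update_of_ne, h0, h1, A.offset_zero]
    simp
  · rintro t s' ⟨N', ⟨hi, -, hb, ha, harr⟩, hlt, ht⟩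
    have hlt' : ¬ s'.r .idx < n + m := hb ▸ hlt
    obtain hidx : s'.r .idx = n + m := by omega
    refine ⟨?_, by rw [ha, hidx, A.offset_last], harr⟩
    simp only [readSizes, List.length_cons, List.length_nil]
    omega

theorem ensures_tabulate (hw : 9 * A.encode.length ≤ w)
    (hinp : s.a .inp = fun i => A.encode.getD i 0) :
    tabulate.Ensures 9 A.encode.length w s fun t s' => t ≤ 13 * (n + m) + 15 ∧
      Loaded A A.encode.length s' ∧ s'.r .numE = m ∧ ∀ j ≠ .off, s'.a j = s.a j := by
  have hlen := A.length_encode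
  have h0 : A.encode.getD 0 0 = n := rfl
  have h1 : A.encode.getD 1 0 = m := rfl
  refine .seq (.block ?_ ?_)
  · simp only [readSizes, SafeAll, Op.Safe, Op.exec, hinp, Arr.ctorIdx, Function.update_self, ne_eq,
      reduceCtorEq, not_false_eq_true, Function.update_of_ne, h0, h1, Nat.ofNat_pos,
      true_and, and_true]
    omega
  refine (Cmd.Ensures.loop_of_invariant (b := .lt .idx .blocks) (N := 13 * (n + m))
    (I := fun N s' => s'.r .idx ≤ n + m ∧ N = 13 * (n + m - s'.r .idx) ∧
      s'.r .blocks = n + m ∧ s'.r .addr = A.offset (s'.r .idx) ∧ s'.r .numV = n ∧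
      s'.r .numE = m ∧ (∀ i < s'.r .idx, s'.a .off i = A.offset i) ∧
      ∀ j ≠ Arr.off, s'.a j = s.a j) ?_ ?_).mono ?_
  · rintro N s' ⟨hi, rfl, hb, ha, hV, hE, htab, harr⟩ hlt
    have hlt' : s'.r .idx < n + m := hb ▸ hlt
    have hil : s'.r .idx < A.lists.length := A.length_lists ▸ hlt'
    have hget := A.getD_offset hil
    have hoff := A.offset_add_lt hil
    have hsucc := A.offset_succ hil
    have hinp' : s'.a .inp = fun i => A.encode.getD i 0 := by rw [harr _ (by simp), hinp]
    refine .block ?_ ⟨_, ⟨?_, rfl, ?_, ?_, ?_, ?_, fun i hi' => ?_, fun j hj => ?_⟩, ?_⟩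
    · simp only [nextList, SafeAll, Op.Safe, Op.exec, hinp', ha, hget, Arr.ctorIdx,
        Function.update_self, ne_eq, reduceCtorEq, not_false_eq_true, Function.update_of_ne,
        Nat.ofNat_pos, true_and, and_true]
      omega
    · simp [nextList, execAll, Op.exec]
      omega
    · simpa [nextList, execAll, Op.exec] using hb
    · simp only [nextList, execAll, Op.exec, hinp', ha, hget, hsucc,
        Function.update_self, ne_eq, reduceCtorEq, not_false_eq_true, Function.update_of_ne]
    · simpa [nextList, execAll, Op.exec] using hV
    · simpa [nextList, execAll, Op.exec] using hE
    · simp only [nextList, execAll, Op.exec, ha, Function.update_self, ne_eq, reduceCtorEq,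
        not_false_eq_true, Function.update_of_ne] at hi' ⊢
      by_cases hii : i = s'.r .idx
      · rw [hii, Function.update_self]
      · rw [Function.update_of_ne hii]
        exact htab i (by omega)
    · simpa [nextList, execAll, Op.exec, hj] using harr j hj
    · simp [nextList, execAll, Op.exec]
      omega
  · simp only [readSizes, execAll, Op.exec, hinp, Function.update_self, ne_eq,
      reduceCtorEq, not_false_eq_true, Function.update_of_ne, h0, h1, A.offset_zero]
    simp
  · rintro t s' ⟨N', ⟨hi, -, hb, -, hV, hE, htab, harr⟩, hlt, ht⟩
    have hlt' : ¬ s'.r .idx < n + m := hb ▸ hlt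
    have hinp' : s'.a .inp = fun i => A.encode.getD i 0 := by rw [harr _ (by simp), hinp]
    refine ⟨?_, ⟨hV, fun v => ?_, fun e => ?_⟩, hE, harr⟩
    · simp only [readSizes, List.length_cons, List.length_nil]
      omega
    · have hv : (v : ℕ) < A.lists.length := by
        rw [A.length_lists]
        omega
      have hl := A.lists_getElem_vertex v
      have hll : A.lists[(v : ℕ)].length = (A.edgesAt v).length := by simp [hl]
      rw [htab v (by omega), hinp', ← hll]
      refine ⟨⟨by rw [← hll]; exact A.offset_add_lt hv, fun i hi => ?_⟩, A.getD_offset hv⟩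
      exact (A.getD_offset_add hv (hll ▸ hi)).trans (by simp [hl])
    · have he : n + (e : ℕ) < A.lists.length := by
        rw [A.length_lists]
        omega
      have hl := A.lists_getElem_edge e
      have hll : A.lists[n + (e : ℕ)].length = (A.verticesOf e).length := by simp [hl]
      rw [htab (n + e) (by omega), hinp', ← hll]
      refine ⟨⟨by rw [← hll]; exact A.offset_add_lt he, fun i hi => ?_⟩, A.getD_offset he⟩
      exact (A.getD_offset_add he (hll ▸ hi)).trans (by simp [hl])

theorem ensures_fillBucket (hD : n + m + 2 * H.totalSize + 2 ≤ D) (hDw : 9 * D ≤ w)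
    {T : SimpleGraph (Fin m)} (hl : Loaded A D s) (hE : s.r .numE = m)
    (ha : ∀ j, j ≠ .inp → j ≠ .off → ∀ i, s.a j i = 0) :
    fillBucket.Ensures 9 D w s fun t s' => t ≤ 17 * m + 15 ∧
      SearchInvariant A D T (20 * m + 10 + 120 * remaining H [] + 45 * H.totalSize) s' := by
  refine .seq (.block ?_ ?_)
  · simp [SafeAll, Op.Safe]
    omega
  refine (Cmd.Ensures.loop_of_invariant (b := .lt .idx .numE) (N := 17 * m)
    (I := fun N s' => s'.r .idx ≤ m ∧ N = 17 * (m - s'.r .idx) ∧ s'.r .numE = m ∧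
      s'.r .free = s'.r .idx ∧ Queue D (fun e : Fin m => (e : ℕ) < s'.r .idx) 0 s'.a (s'.r .free) ∧
      s'.r .bucket = 1 ∧ s'.r .numV = s.r .numV ∧ s'.r .out = 0 ∧ s'.r .time = 0 ∧
      s'.r .best = 1 ∧ ∀ j ∉ [Arr.head, .ent, .nxt], s'.a j = s.a j) ?_ ?_).mono ?_
  · rintro N s' ⟨hi, rfl, hE', hfree, hq, hy, hV, hout, htime, hbest, harr⟩ hlt
    have hlt' : s'.r .idx < m := hE' ▸ hlt
    have hcnt : ∀ i, s'.a .cnt i = 0 := fun i => by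
      rw [harr _ (by simp), ha _ (by simp) (by simp)]
    refine .block ?_ ⟨_, ⟨?_, rfl, ?_, ?_, ?_, ?_, ?_, ?_, ?_, ?_, fun j hj => ?_⟩, ?_⟩
    · simp [pushOps, SafeAll, Op.Safe, Op.exec, Arr.ctorIdx, hy, hfree]
      omega
    · simp [pushOps, execAll, Op.exec]
      omega
    · simpa [pushOps, execAll, Op.exec] using hE'
    · simpa [pushOps, execAll, Op.exec] using hfree
    · have hf : (execAll s' (.subc .nbr .idx 0 :: (pushOps ++ [.addc .idx .idx 1]))).r .free =
          s'.r .free + 1 := by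
        simp [pushOps, execAll, Op.exec]
      rw [hf]
      refine (hq.push (f := ⟨s'.r .idx, hlt'⟩) (y := 1) (by omega) (by omega) ?_ ?_ ?_ ?_).imp ?_
      · simp [pushOps, execAll, Op.exec]
      · simp [pushOps, execAll, Op.exec]
      · simp [pushOps, execAll, Op.exec, hy]
      · simp [pushOps, execAll, Op.exec, hy]
      · intro e he
        simp only [pushOps, execAll, Op.exec, List.cons_append, List.nil_append,
          Function.update_self, ne_eq, reduceCtorEq, not_false_eq_true, Function.update_of_ne] at he
        simp only [hcnt, and_true, Fin.ext_iff]
        omega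
    · simpa [pushOps, execAll, Op.exec] using hy
    · simpa [pushOps, execAll, Op.exec] using hV
    · simpa [pushOps, execAll, Op.exec] using hout
    · simpa [pushOps, execAll, Op.exec] using htime
    · simpa [pushOps, execAll, Op.exec] using hbest
    · rw [← harr j hj]
      simp only [List.mem_cons, not_or] at hj
      simp [pushOps, execAll, Op.exec, hj]
    · simp [pushOps, execAll, Op.exec]
      omega
  · simp only [execAll, Op.exec, Function.update_self, ne_eq, reduceCtorEq, not_false_eq_true,
      Function.update_of_ne, hE, Nat.not_lt_zero]
    simpa using queue_empty (ha _ (by simp) (by simp))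
  · rintro t s' ⟨N', ⟨hi, -, hE', hfree, hq, hy, hV, hout, htime, hbest, harr⟩, hlt, ht⟩
    have hlt' : ¬ s'.r .idx < m := hE' ▸ hlt
    have hidx : s'.r .idx = m := by omega
    have h0 : ∀ j ∉ [Arr.head, .ent, .nxt, .inp, .off], ∀ i, s'.a j i = 0 := fun j hj i => by
      simp only [List.mem_cons, not_or] at hj
      rw [harr j (by simp [hj]), ha j hj.2.2.2.1 hj.2.2.2.2.1]
    have hcnt := h0 .cnt (by simp)
    have hcov := h0 .cov (by simp)
    have hsel := h0 .sel (by simp)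
    have hsize := h0 .size (by simp)
    refine ⟨?_, [], 0, ⟨⟨hl.congr hV (harr _ (by simp)) (harr _ (by simp)), hq.imp ?_, ?_, ?_⟩,
      componentsAttached_nil, trivial, ?_, ?_, ?_, htime, ?_, ?_, ?_⟩, ?_⟩
    · simp only [List.length_cons, List.length_nil]
      omega
    · intro e _
      rw [hidx]
      exact e.2
    · simp [hcnt, hcov]
    · simp [hcov, hfree, hidx, A.sum_length_edgesAt]
    · simp [hsel]
    · simp [hcov, coverTime]
    · simp [hsize, sizeSucc]
    · simp [hout, PairFound]
    · simp [hcnt, hbest]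
    · omega
    · rw [hfree, hidx, hbest]
      omega

end Correctness

section Correctness

variable {n m : ℕ} {H : IndexedHypergraph (Fin n) (Fin m)} {A : H.AdjacencyLists}
  {K D w : ℕ} {s : State}

open Classical in
theorem ensures_search_program (hw : 9 * A.encode.length ≤ w) {T : SimpleGraph (Fin m)}
    (hT : H.IsJoinTree T) (hinp : s.a .inp = fun i => A.encode.getD i 0)
    (ha : ∀ j ≠ .inp, ∀ i, s.a j i = 0) :
    search.Ensures 9 A.encode.length w s fun t s' =>
      t ≤ 13 * n + 170 * m + 165 * H.totalSize + 50 ∧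
      s'.r .out = if H.HasSpernerPair then 1 else 0 := by
  have hD := A.length_encode.ge
  refine .seq ((ensures_tabulate hw hinp).mono ?_)
  rintro t₁ s₁ ⟨ht₁, hl, hE, harr⟩
  refine .seq ((ensures_fillBucket (T := T) hD hw hl hE ?_).mono ?_)
  · intro j h1 h2
    rw [harr j h2]
    exact ha j h1
  rintro t₂ s₂ ⟨ht₂, hI⟩
  refine (ensures_search hD hw hT hI).mono ?_
  rintro t₃ s₃ ⟨ht₃, hout⟩
  refine ⟨?_, hout⟩
  have hrem : remaining H [] = H.totalSize + m := by
    simp [remaining, Finset.sum_add_distrib, totalSize]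
  rw [hrem] at ht₃
  omega

/-- Compute the base addresses of further `k` arrays, when there are `K` arrays already. -/
def extendBases : ℕ → ℕ → List Instr
  | _, 0 => []
  | K, k + 1 => .add (2 * K + 3) (2 * K + 1) Var.addr.reg :: extendBases (K + 1) k

theorem length_extendBases (K k : ℕ) : (extendBases K k).length = k := by
  induction k generalizing K with
  | zero => rfl
  | succ k ih => simp [extendBases, ih]

theorem Represents.extend {conf : Config} (h : Represents K D w conf s) (hK : 0 < K)
    (hw : (K + 1) * D ≤ w) (hD : s.r .addr = D) :
    Represents (K + 1) D w (Instr.exec conf (.add (2 * K + 3) (2 * K + 1) Var.addr.reg))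
      ⟨s.r, fun j => if j.ctorIdx < K then s.a j else fun _ => 0⟩ := by
  obtain ⟨pc, reg, mem⟩ := conf
  have hsum : reg (2 * K + 1) + reg Var.addr.reg = K * D := by
    have h1 : reg (2 * (K - 1) + 3) = (K - 1) * D := h.base (K - 1) (by omega)
    have h2 : reg Var.addr.reg = D := (h.var .addr).trans hD
    rw [show 2 * K + 1 = 2 * (K - 1) + 3 by omega, h1, h2, ← Nat.succ_mul]
    congr 1
    omega
  simp only [Instr.exec, hsum]
  refine ⟨fun x => ?_, fun j hj => ?_, fun j hj i hi => ?_, fun i hi => ?_, ?_, hw⟩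
  · have h0 := h.var x
    dsimp only at h0 ⊢
    rwa [Function.update_of_ne (by rw [Var.reg]; omega)]
  · dsimp only
    by_cases hjK : j = K
    · rw [hjK, Function.update_self]
    · have h0 := h.base j (by omega)
      dsimp only at h0
      rwa [Function.update_of_ne (by omega)]
  · dsimp only
    split_ifs with hjK
    · exact h.arr j hjK i hi
    · exact h.zero _ ((Nat.mul_le_mul_right D (not_lt.mp hjK)).trans (Nat.le_add_right _ _))
  · exact h.zero i ((Nat.mul_le_mul_right D (Nat.le_succ K)).trans hi)
  · exact h.bounded.update_reg h.size

theorem Represents.reach_extendBases {P : Program} {k l : ℕ} {conf : Config}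
    (hP : Placed P l (extendBases K k)) (hpc : conf.pc = l) (h : Represents K D w conf s)
    (hK : 0 < K) (hw : (K + k) * D ≤ w) (hD : s.r .addr = D) :
    ∃ conf' s', Reach P w k conf conf' ∧ conf'.pc = l + k ∧ Represents (K + k) D w conf' s' ∧
      ∀ j : Arr, s'.a j = if j.ctorIdx < K then s.a j else fun _ => 0 := by
  induction k generalizing K l conf s with
  | zero =>
    refine ⟨conf, ⟨s.r, fun j => if j.ctorIdx < K then s.a j else fun _ => 0⟩, .refl h.bounded, hpc,
      ⟨h.var, h.base, fun j hj i hi => ?_, h.zero, h.bounded, h.size⟩, fun j => rfl⟩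
    simpa [show j.ctorIdx < K from hj] using h.arr j hj i hi
  | succ k ih =>
    have hw' : (K + 1) * D ≤ w := (Nat.mul_le_mul_right D (by omega)).trans hw
    have h₁ := h.extend hK hw' hD
    subst hpc
    have hr := Reach.of_exec hP.1 h.bounded h₁.bounded
    obtain ⟨conf', s', h2, h3, h4, h5⟩ := ih hP.2 rfl h₁ (by omega)
      (by rwa [Nat.add_assoc, Nat.add_comm 1]) hD
    refine ⟨conf', s', Nat.add_comm 1 k ▸ hr.trans h2, by rw [h3]; omega, ?_, fun j => ?_⟩
    · rwa [Nat.add_assoc, Nat.add_comm 1] at h4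
    · rw [h5]
      by_cases hjK : j.ctorIdx < K
      · simp [hjK, Nat.lt_succ_of_lt hjK]
      · simp [hjK]

/-- The program that solves the Sperner Family problem for acyclic hypergraphs. -/
def spernerProgram : Program :=
  measure.compile 0 ++ (extendBases 1 8 ++ search.compile (measure.len + 8))

theorem placed_spernerProgram : Placed spernerProgram 0 (measure.compile 0) ∧
    Placed spernerProgram measure.len (extendBases 1 8) ∧
    Placed spernerProgram (measure.len + 8) (search.compile (measure.len + 8)) := by
  have h := placed_self [] spernerProgram []
  simp only [List.nil_append, List.append_nil, List.length_nil] at h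
  obtain ⟨h1, h2⟩ := placed_append.mp h
  obtain ⟨h2, h3⟩ := placed_append.mp h2
  simp only [Cmd.length_compile, length_extendBases, Nat.zero_add] at h2 h3
  exact ⟨h1, h2, h3⟩

theorem represents_init (hw : A.encode.length ≤ w) :
    Represents 1 A.encode.length w (init A.encode)
      ⟨fun _ => 0, fun _ i => A.encode.getD i 0⟩ where
  var _ := rfl
  base j hj := by
    obtain rfl : j = 0 := by omega
    simp [init]
  arr j hj i _ := by
    have : j.ctorIdx = 0 := by omega
    simp [init, this]
  zero i hi := by
    rw [Nat.one_mul] at hi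
    exact List.getD_eq_default _ _ hi
  bounded i := by
    refine ⟨Nat.zero_le _, ?_⟩
    simp only [init]
    by_cases hi : i < A.encode.length
    · rw [List.getD_eq_getElem _ _ hi]
      have h1 := A.encode_le (List.getElem_mem hi)
      have h2 := A.length_encode
      omega
    · rw [List.getD_eq_default _ _ (by omega)]
      exact Nat.zero_le _
  size := by omega

open Classical in
/-- The program is correct and runs in linear time. -/
theorem computesWithin_spernerProgram (hH : ∀ v, ∃ e, v ∈ H.edge e) (hac : H.IsAcyclic)
    (A : H.AdjacencyLists) :
    ComputesWithin spernerProgram A.encode (if H.HasSpernerPair then 1 else 0)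
      (1000 * H.totalSize) (1000 * H.totalSize) := by
  obtain ⟨T, hT⟩ := hac
  have hm0 : 0 < m := by
    obtain ⟨e⟩ := hT.isTree.connected.nonempty
    exact e.pos
  have hm : m ≤ H.totalSize := by
    have : ∑ _e : Fin m, 1 ≤ ∑ e, (H.edge e).card :=
      Finset.sum_le_sum fun e _ => (H.nonempty e).card_pos
    simpa [totalSize] using this
  have hn : n ≤ H.totalSize := by
    have : ∑ _v : Fin n, 1 ≤ ∑ v, (A.edgesAt v).length := Finset.sum_le_sum fun v _ => by
      obtain ⟨e, he⟩ := hH v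
      exact List.length_pos_of_mem ((A.mem_edgesAt v e).mpr he)
    simpa [A.sum_length_edgesAt] using this
  have hlen := A.length_encode
  have hw : 9 * A.encode.length ≤ 1000 * H.totalSize := by omega
  obtain ⟨hP₁, hP₂, hP₃⟩ := placed_spernerProgram
  obtain ⟨t₁, c₁, s₁, hr₁, hpc₁, hR₁, ht₁, haddr, ha₁⟩ :=
    ensures_measure (by omega) rfl _ _ hP₁ (init A.encode) rfl
      (represents_init (w := 1000 * H.totalSize) (by omega))
  rw [Nat.zero_add] at hpc₁
  obtain ⟨c₂, s₂, hr₂, hpc₂, hR₂, ha₂⟩ := hR₁.reach_extendBases hP₂ hpc₁ (by omega) hw haddr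
  obtain ⟨t₃, c₃, s₃, hr₃, hpc₃, hR₃, ht₃, hout⟩ :=
    ensures_search_program (A := A) (s := s₂) hw hT (by rw [ha₂, if_pos (by decide), ha₁]) (fun j hj i => by
      rw [ha₂, if_neg]
      intro h
      exact hj (Arr.ctorIdx_injective (Nat.lt_one_iff.mp h))) _ _ hP₃ c₂ hpc₂ hR₂
  obtain ⟨hfinal, hbounded⟩ := ((hr₁.trans hr₂).trans hr₃).iterate
  refine ⟨_, ?_, ?_, ?_, hbounded⟩
  · omega
  · rw [hfinal, Halted, hpc₃]
    simp [spernerProgram, length_extendBases, Nat.add_assoc]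
  · rw [hfinal, ← hout]
    exact hR₃.var .out

end Correctness

end RAM

open Classical in
/-- There is a linear-time algorithm to solve the Sperner Family problem for acyclic hypergraphs,
and the criterion in terms of a join tree. -/
theorem mainTheorem5 :
    -- for every join tree `T`: a Sperner pair exists iff the separator `S` of some edge of `T`
    -- has the size of one of the two hyperedges
    (∀ (V E : Type*) (H : IndexedHypergraph V E) (T : SimpleGraph E), H.IsJoinTree T →
      (H.HasSpernerPair ↔
        ∃ e f : E, T.Adj e f ∧
          ((H.separator e f).card = (H.edge e).card ∨
            (H.separator e f).card = (H.edge f).card))) ∧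
    -- a single RAM program decides the problem in `O(N)` steps
    (∃ (P : RAM.Program) (C : ℕ),
      ∀ (n m : ℕ) (H : IndexedHypergraph (Fin n) (Fin m)),
        (∀ v, ∃ e, v ∈ H.edge e) → H.IsAcyclic →
        ∀ A : H.AdjacencyLists,
          RAM.ComputesWithin P A.encode (if H.HasSpernerPair then 1 else 0)
            (C * H.totalSize) (C * H.totalSize)) := by
  exact ⟨fun V E H T hT => hT.hasSpernerPair_iff,
    RAM.spernerProgram, 1000, fun n m H hH hac A => RAM.computesWithin_spernerProgram hH hac A⟩
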